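/- Let $E$ be a finite-dimensional real normed space (for instance $\mathbb{R}^n$ with any norm), let $\mathcal{L}(E)$ carry the operator norm, and let $A:[0,\infty)\to\mathcal{L}(E)$ be of bounded variation on every compact subinterval, left-continuous on $(0,\infty)$, and satisfy (D) $I-\Delta^-A(t)$ is invertible for all $t>0$ and $I+\Delta^+A(t)$ is invertible for all $t\ge 0$, where $\Delta^-A(t)=A(t)-A(t^-)$ and $\Delta^+A(t)=A(t^+)-A(t)$. Integrals $\int_a^b \mathrm{d}[A(s)]x(s)$ are Kurzweil–Stieltjes integrals, i.e. the limits, over gauge-fine tagged partitions $(\alpha_j,\tau_j)$ of $[a,b]$, of the sums $\sum_j [A(\alpha_j)-A(\alpha_{j-1})]x(\tau_j)$, with $\int_b^a=-\int_a^b$. A function $x$ is a solution of $\frac{dx}{d\tau}=D[A(t)x]$ on $[s_0,\infty)$ if $x(d)-x(c)=\int_c^d \mathrm{d}[A(s)]x(s)$ (the integral existing) for all $s_0\le c\le d$. The trivial solution $x\equiv0$ of this equation is called * *uniformly stable* if for every $\varepsilon>0$ there is $\delta>0$ such that for all $s_0\ge0$ every solution $x$ on $[s_0,\infty)$ with $\|x(s_0)\|<\delta$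 satisfies $\|x(t)\|<\varepsilon$ for all $t\ge s_0$; *uniformly asymptotically stable* if moreover there is $\delta_0>0$ such that for every $\varepsilon>0$ there is $T\ge0$ such that for all $s_0\ge 0$ every solution $x$ on $[s_0,\infty)$ with $\|x(s_0)\|<\delta_0$ satisfies $\|x(t)\|<\varepsilon$ for all $t\ge s_0+T$; * *globally uniformly exponentially stable* if there are $K,\alpha>0$ such that for all $s_0\ge0$ every solution $x$ on $[s_0,\infty)$ satisfies $\|x(t)\|\le K\|x(s_0)\|e^{-\alpha(t-s_0)}$ for all $t\ge s_0$. For $s_0\ge 0$ let $\mathcal{Y}_{s_0}$ be the set of functions $y:[s_0,\infty)\to E$ that are locally of bounded variation on $[s_0,\infty)$ and left-continuous on $(s_0,\infty)$, and for $y\in\mathcal{Y}_{s_0}$ put $$V_{s_0}(y)=\sup_{t\ge s_0}\operatorname{var}_{s_0}^{t}\Big(s\mapsto y(s)-\int_{s_0}^{s}\mathrm{d}[A(\xi)]y(\xi)\Big)\in[0,\infty].$$ The trivial solution is called * *variationally stable* if for every $\varepsilon>0$ there is $\delta>0$ such that for all $s_0\ge0$ and $y\in\mathcal{Y}_{s_0}$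 with $\|y(s_0)\|<\delta$ and $V_{s_0}(y)<\delta$ one has $\|y(t)\|<\varepsilon$ for all $t\ge s_0$; * *variationally attracting* if there is $\delta_0>0$ such that for every $\varepsilon>0$ there are $T\ge0$ and $\gamma>0$ such that for all $s_0\ge0$ and $y\in\mathcal{Y}_{s_0}$ with $\|y(s_0)\|<\delta_0$ and $V_{s_0}(y)<\gamma$ one has $\|y(t)\|<\varepsilon$ for all $t\ge s_0+T$; * *variationally asymptotically stable* if it is variationally stable and variationally attracting. **Theorem.** There is a unique function $U:[0,\infty)\times[0,\infty)\to\mathcal{L}(E)$ with $U(t,s)=I+\int_s^t \mathrm{d}[A(r)]U(r,s)$ for all $t,s\ge0$ (the transition matrix), and the trivial solution is variationally asymptotically stable if and only if there are constants $K,\alpha>0$ such that $$\|U(t,s)\|\le K e^{-\alpha(t-s)}\qquad\text{for all } t\ge s\ge0 .$$ Moreover, the trivial solution is variationally asymptotically stable if and only if it is uniformly asymptotically stable, and if and only if it is globally uniformly exponentially stable. -/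

import Mathlib

open Set Filter Topology

namespace GLDE

section Kurzweil

variable {X : Type*} [NormedAddCommGroup X]

/-- A tagged partition `a = pt 0 < pt 1 < ⋯ < pt size = b` of `[a, b]`, with a tag
`tag j ∈ [pt j, pt (j + 1)]` for each `j < size`. The values of `pt` beyond `size`, and of `tag`
from `size` on, play no role. If `a = b` then `size = 0`; if `b < a` there is none. -/
structure TaggedPartition (a b : ℝ) where
  /-- the number of subintervals -/
  size : ℕ
  /-- the division points -/
  pt : ℕ → ℝ
  /-- the tags -/
  tag : ℕ → ℝ
  pt_zero : pt 0 = a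
  pt_size : pt size = b
  pt_lt : ∀ j < size, pt j < pt (j + 1)
  tag_mem : ∀ j < size, tag j ∈ Icc (pt j) (pt (j + 1))

/-- A tagged partition is `δ`-fine if each subinterval lies in
`(tag - δ (tag), tag + δ (tag))`. -/
def TaggedPartition.IsFine {a b : ℝ} (P : TaggedPartition a b) (δ : ℝ → ℝ) : Prop :=
  ∀ j < P.size, Icc (P.pt j) (P.pt (j + 1)) ⊆
    Ioo (P.tag j - δ (P.tag j)) (P.tag j + δ (P.tag j))

/-- The sum `∑ⱼ [G(τⱼ, αⱼ) - G(τⱼ, αⱼ₋₁)]` over a tagged partition. -/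
def TaggedPartition.sum {a b : ℝ} (P : TaggedPartition a b) (G : ℝ → ℝ → X) : X :=
  ∑ j ∈ Finset.range P.size, (G (P.tag j) (P.pt (j + 1)) - G (P.tag j) (P.pt j))

/-- For `a ≤ b`: `I` is the Kurzweil integral `∫_a^b D G(τ, t)`. -/
def HasKurzweilIntegral (G : ℝ → ℝ → X) (a b : ℝ) (I : X) : Prop :=
  ∀ ε > 0, ∃ δ : ℝ → ℝ, (∀ t ∈ Icc a b, 0 < δ t) ∧
    ∀ P : TaggedPartition a b, P.IsFine δ → ‖P.sum G - I‖ < ε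

/-- For `a ≤ b`: Kurzweil integrability of `G` on `[a, b]`. -/
def KurzweilIntegrable (G : ℝ → ℝ → X) (a b : ℝ) : Prop :=
  ∃ I : X, HasKurzweilIntegral G a b I

open Classical in
/-- The Kurzweil integral `∫_a^b D G(τ, t)`, with `∫_a^b = - ∫_b^a` if `b < a`
(and the value `0` if `G` is not integrable). -/
noncomputable def kurzweilIntegral (G : ℝ → ℝ → X) (a b : ℝ) : X :=
  if a ≤ b then
    if h : KurzweilIntegrable G a b then h.choose else 0
  else
    if h : KurzweilIntegrable G b a then -h.choose else 0

/-- Adding one more subinterval on the right of a tagged partition. -/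
def TaggedPartition.snoc {a b : ℝ} (P : TaggedPartition a b) (c τ : ℝ) (hbc : b < c)
    (hτ : τ ∈ Icc b c) : TaggedPartition a c where
  size := P.size + 1
  pt := fun j => if j ≤ P.size then P.pt j else c
  tag := fun j => if j < P.size then P.tag j else τ
  pt_zero := by simp [P.pt_zero]
  pt_size := by simp
  pt_lt := by
    intro j hj
    rcases Nat.lt_succ_iff_lt_or_eq.1 hj with h | rfl
    · simpa [h.le, Nat.succ_le_of_lt h] using P.pt_lt j h
    · simpa [P.pt_size] using hbc
  tag_mem := by
    intro j hj
    rcases Nat.lt_succ_iff_lt_or_eq.1 hj with h | rfl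
    · simpa [h, h.le, Nat.succ_le_of_lt h] using P.tag_mem j h
    · simpa [P.pt_size] using hτ

theorem TaggedPartition.IsFine.snoc {a b : ℝ} {P : TaggedPartition a b} {δ : ℝ → ℝ}
    (hP : P.IsFine δ) (c τ : ℝ) (hbc : b < c) (hτ : τ ∈ Icc b c)
    (h : Icc b c ⊆ Ioo (τ - δ τ) (τ + δ τ)) : (P.snoc c τ hbc hτ).IsFine δ := by
  intro j hj
  rcases Nat.lt_succ_iff_lt_or_eq.1 hj with h' | rfl
  · simpa [TaggedPartition.snoc, h', h'.le, Nat.succ_le_of_lt h'] using hP j h'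
  · simpa [TaggedPartition.snoc, P.pt_size] using h

/-- Fine tagged partitions exist for every gauge (Cousin's lemma). -/
theorem exists_isFine {a b : ℝ} (hab : a ≤ b) (δ : ℝ → ℝ) (hδ : ∀ t ∈ Icc a b, 0 < δ t) :
    ∃ P : TaggedPartition a b, P.IsFine δ := by
  let S : Set ℝ := {c | c ∈ Icc a b ∧ ∃ P : TaggedPartition a c, P.IsFine δ}
  have haS : a ∈ S := ⟨⟨le_rfl, hab⟩, ⟨0, fun _ => a, fun _ => a, rfl, rfl, by simp, by simp⟩,
    fun j hj => by simp at hj⟩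
  have hbdd : BddAbove S := ⟨b, fun c hc => hc.1.2⟩
  set c := sSup S with hc
  have hac : a ≤ c := le_csSup hbdd haS
  have hcb : c ≤ b := csSup_le ⟨a, haS⟩ fun x hx => hx.1.2
  have hδc := hδ c ⟨hac, hcb⟩
  have hcS : c ∈ S := by
    obtain ⟨d, hd, hdc⟩ := exists_lt_of_lt_csSup ⟨a, haS⟩ (show c - δ c < sSup S by linarith)
    rcases (le_csSup hbdd hd).eq_or_lt with h | h
    · exact hc ▸ h ▸ hd
    · obtain ⟨P, hP⟩ := hd.2
      refine ⟨⟨hac, hcb⟩, P.snoc c c h ⟨h.le, le_rfl⟩, hP.snoc c c h ⟨h.le, le_rfl⟩ ?_⟩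
      intro x hx
      exact ⟨by linarith [hx.1], by linarith [hx.2]⟩
  rcases hcb.eq_or_lt with h | h
  · exact h ▸ hcS.2
  · exfalso
    obtain ⟨P, hP⟩ := hcS.2
    have hlt : c < min b (c + δ c / 2) := lt_min h (by linarith)
    have hmem : min b (c + δ c / 2) ∈ S := by
      refine ⟨⟨hac.trans hlt.le, min_le_left _ _⟩, P.snoc _ c hlt ⟨le_rfl, hlt.le⟩,
        hP.snoc _ c hlt ⟨le_rfl, hlt.le⟩ ?_⟩
      intro x hx
      have := hx.2.trans (min_le_right _ _)
      exact ⟨by linarith [hx.1], by linarith⟩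
    exact absurd (le_csSup hbdd hmem) (not_le.2 hlt)

/-- The Kurzweil integral is unique. -/
theorem HasKurzweilIntegral.unique {G : ℝ → ℝ → X} {a b : ℝ} (hab : a ≤ b) {I J : X}
    (hI : HasKurzweilIntegral G a b I) (hJ : HasKurzweilIntegral G a b J) : I = J := by
  by_contra hne
  have hpos : 0 < ‖I - J‖ / 2 := half_pos (norm_pos_iff.2 (sub_ne_zero.2 hne))
  obtain ⟨δ₁, h₁, H₁⟩ := hI _ hpos
  obtain ⟨δ₂, h₂, H₂⟩ := hJ _ hpos
  obtain ⟨P, hP⟩ := exists_isFine hab (fun t => min (δ₁ t) (δ₂ t))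
    fun t ht => lt_min (h₁ t ht) (h₂ t ht)
  have k₁ := H₁ P fun j hj => (hP j hj).trans
    (Ioo_subset_Ioo (sub_le_sub_left (min_le_left _ _) _) (add_le_add_right (min_le_left _ _) _))
  have k₂ := H₂ P fun j hj => (hP j hj).trans
    (Ioo_subset_Ioo (sub_le_sub_left (min_le_right _ _) _)
      (add_le_add_right (min_le_right _ _) _))
  have := norm_sub_le (P.sum G - J) (P.sum G - I)
  rw [sub_sub_sub_cancel_left] at this
  linarith

theorem HasKurzweilIntegral.integral_eq {G : ℝ → ℝ → X} {a b : ℝ} (hab : a ≤ b) {I : X}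
    (hI : HasKurzweilIntegral G a b I) : kurzweilIntegral G a b = I := by
  have h : KurzweilIntegrable G a b := ⟨I, hI⟩
  rw [kurzweilIntegral, if_pos hab, dif_pos h]
  exact h.choose_spec.unique hab hI

end Kurzweil

section Equation

variable {E : Type*} [NormedAddCommGroup E] [NormedSpace ℝ E]

/-- Condition (D): `I - Δ⁻A(t)` is invertible for `t > 0` and `I + Δ⁺A(t)` is invertible for
`t ≥ 0`, where `Δ⁻A(t) = A(t) - A(t⁻)` and `Δ⁺A(t) = A(t⁺) - A(t)`. -/
def ConditionD (A : ℝ → E →L[ℝ] E) : Prop :=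
  (∀ t > 0, IsUnit (1 - (A t - Function.leftLim A t))) ∧
    ∀ t ≥ 0, IsUnit (1 + (Function.rightLim A t - A t))

/-- `x` is a solution on the interval `J` of the homogeneous equation `dx/dτ = D[A(t)x]`:
`x(d) - x(c) = ∫_c^d d[A(s)] x(s)` whenever `[c, d] ⊆ J`. -/
def IsSolutionOn (A : ℝ → E →L[ℝ] E) (J : Set ℝ) (x : ℝ → E) : Prop :=
  ∀ c d, c ≤ d → Icc c d ⊆ J →
    HasKurzweilIntegral (fun τ t => A t (x τ)) c d (x d - x c)

/-- `U` is a transition matrix on `[0, ∞)`: for all `t, s ≥ 0` (in either order) the integral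
exists and `U(t, s) = I + ∫_s^t d[A(r)] U(r, s)`. -/
def IsTransitionMatrix (A : ℝ → E →L[ℝ] E) (U : ℝ → ℝ → E →L[ℝ] E) : Prop :=
  ∀ t ≥ 0, ∀ s ≥ 0,
    KurzweilIntegrable (fun τ r => A r * U τ s) (min s t) (max s t) ∧
      U t s = 1 + kurzweilIntegral (fun τ r => A r * U τ s) s t

/-- `‖U(t, s)‖ ≤ K e^{-α (t - s)}` for all `t ≥ s ≥ 0`, for some `K, α > 0`. -/
def HasUniformExponentialDecay (U : ℝ → ℝ → E →L[ℝ] E) : Prop :=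
  ∃ K > 0, ∃ α > 0, ∀ s ≥ 0, ∀ t ≥ s, ‖U t s‖ ≤ K * Real.exp (-α * (t - s))

/-- Uniform stability of the trivial solution. -/
def UniformlyStable (A : ℝ → E →L[ℝ] E) : Prop :=
  ∀ ε > 0, ∃ δ > 0, ∀ s₀ ≥ 0, ∀ x : ℝ → E, IsSolutionOn A (Ici s₀) x → ‖x s₀‖ < δ →
    ∀ t ≥ s₀, ‖x t‖ < ε

/-- Uniform asymptotic stability of the trivial solution. -/
def UniformlyAsymptoticallyStable (A : ℝ → E →L[ℝ] E) : Prop :=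
  UniformlyStable A ∧
    ∃ δ₀ > 0, ∀ ε > 0, ∃ T ≥ 0, ∀ s₀ ≥ 0, ∀ x : ℝ → E, IsSolutionOn A (Ici s₀) x →
      ‖x s₀‖ < δ₀ → ∀ t ≥ s₀ + T, ‖x t‖ < ε

/-- Global uniform exponential stability of the trivial solution. -/
def GloballyUniformlyExponentiallyStable (A : ℝ → E →L[ℝ] E) : Prop :=
  ∃ K > 0, ∃ α > 0, ∀ s₀ ≥ 0, ∀ x : ℝ → E, IsSolutionOn A (Ici s₀) x →
    ∀ t ≥ s₀, ‖x t‖ ≤ K * ‖x s₀‖ * Real.exp (-α * (t - s₀))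

/-- The total variation
`sup_{t ≥ s₀} var_{s₀}^t (y(s) - ∫_{s₀}^s d[A(ξ)] y(ξ))`. -/
noncomputable def defectVariation (A : ℝ → E →L[ℝ] E) (s₀ : ℝ) (y : ℝ → E) : ENNReal :=
  ⨆ t ≥ s₀, eVariationOn
    (fun s => y s - kurzweilIntegral (fun τ r => A r (y τ)) s₀ s) (Icc s₀ t)

/-- The test functions of variational stability: locally of bounded variation on `[s₀, ∞)` and
left-continuous on `(s₀, ∞)`. -/
def IsAdmissible (s₀ : ℝ) (y : ℝ → E) : Prop :=
  LocallyBoundedVariationOn y (Ici s₀) ∧ ∀ t > s₀, ContinuousWithinAt y (Iio t) t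

/-- Variational stability of the trivial solution. -/
def VariationallyStable (A : ℝ → E →L[ℝ] E) : Prop :=
  ∀ ε > 0, ∃ δ > 0, ∀ s₀ ≥ 0, ∀ y : ℝ → E, IsAdmissible s₀ y → ‖y s₀‖ < δ →
    defectVariation A s₀ y < ENNReal.ofReal δ → ∀ t ≥ s₀, ‖y t‖ < ε

/-- Variational attractivity of the trivial solution. -/
def VariationallyAttracting (A : ℝ → E →L[ℝ] E) : Prop :=
  ∃ δ₀ > 0, ∀ ε > 0, ∃ T ≥ 0, ∃ γ > 0, ∀ s₀ ≥ 0, ∀ y : ℝ → E, IsAdmissible s₀ y →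
    ‖y s₀‖ < δ₀ → defectVariation A s₀ y < ENNReal.ofReal γ → ∀ t ≥ s₀ + T, ‖y t‖ < ε

/-- Variational asymptotic stability of the trivial solution. -/
def VariationallyAsymptoticallyStable (A : ℝ → E →L[ℝ] E) : Prop :=
  VariationallyStable A ∧ VariationallyAttracting A

end Equation

end GLDE

/-! Everything is driven by one scalar function: a monotone left-continuous `v` with `‖A d - A c‖ ≤
v d - v c` for `0 ≤ c ≤ d`. To evaluate or bound an integral it suffices to compare increments near
each tag (`LocallyApprox`), and Cousin's lemma glues local statements together (`interval_chain`).

Left-continuity makes the forward problem well posed whatever the size of the jumps: integration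
halves bounds in the weight `exp (2 v)` (`IsControl.norm_integral_le_exp`), so Picard iteration
converges and solutions are unique. This gives the fundamental matrix `Φ t s` for `t ≥ s` and its
cocycle identity. It is invertible, since locally it is close to `I` on intervals ending at a point
and close to the invertible `I + Δ⁺A` on intervals starting there. The inverses supply the
transition matrix backward in time.

For stability one goes round a cycle: variational asymptotic stability, uniform asymptotic
stability, exponential decay of `Φ`, and back. The first implication holds because solutions have
zero defect. The second extracts a uniform bound for `Φ` and a time after which `‖Φ‖ ≤ 1/2`, and
then iterates the cocycle identity. The third rests on `‖y t - Φ t s (y s)‖ ≤ K V`, where `V` is the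
variation of the defect of `y` and `K` bounds `‖Φ t r‖` for `s ≤ r ≤ t`
(`IsForwardMatrix.norm_sub_le`). No variation of constants formula is needed: the function `r ↦ Φ t
r (y r)` is telescoped over short intervals, each costing at most `K / (1 - κ)` times the defect's
variation there, and `κ` tends to `0`. Global exponential stability is the decay of `Φ` applied to
vectors, and it implies uniform asymptotic stability. -/

namespace GLDE

/-! ### Tagged partitions and general properties of the Kurzweil integral. -/

section KurzweilBasics

variable {X Y : Type*} [NormedAddCommGroup X] [NormedAddCommGroup Y]

namespace TaggedPartition

variable {a b c : ℝ}

theorem pt_mono (P : TaggedPartition a b) {i j : ℕ} (hij : i ≤ j) (hj : j ≤ P.size) :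
    P.pt i ≤ P.pt j := by
  induction j, hij using Nat.le_induction with
  | base => exact le_rfl
  | succ k _ ih => exact (ih (by omega)).trans (P.pt_lt k (by omega)).le

theorem left_le_pt (P : TaggedPartition a b) {j : ℕ} (hj : j ≤ P.size) : a ≤ P.pt j :=
  P.pt_zero.symm.le.trans (P.pt_mono (Nat.zero_le j) hj)

theorem pt_le_right (P : TaggedPartition a b) {j : ℕ} (hj : j ≤ P.size) : P.pt j ≤ b :=
  (P.pt_mono hj le_rfl).trans P.pt_size.le

theorem tag_mem_Icc (P : TaggedPartition a b) {j : ℕ} (hj : j < P.size) : P.tag j ∈ Icc a b :=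
  ⟨(P.left_le_pt hj.le).trans (P.tag_mem j hj).1, (P.tag_mem j hj).2.trans (P.pt_le_right hj)⟩

theorem sum_add (P : TaggedPartition a b) (G H : ℝ → ℝ → X) :
    P.sum (fun τ t => G τ t + H τ t) = P.sum G + P.sum H := by
  simp only [TaggedPartition.sum, ← Finset.sum_add_distrib]
  exact Finset.sum_congr rfl fun _ _ => by abel

theorem sum_sub (P : TaggedPartition a b) (G H : ℝ → ℝ → X) :
    P.sum (fun τ t => G τ t - H τ t) = P.sum G - P.sum H := by
  simp only [TaggedPartition.sum, ← Finset.sum_sub_distrib]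
  exact Finset.sum_congr rfl fun _ _ => by abel

theorem sum_congr (P : TaggedPartition a b) {G H : ℝ → ℝ → X}
    (h : ∀ τ ∈ Icc a b, ∀ t ∈ Icc a b, G τ t = H τ t) : P.sum G = P.sum H := by
  refine Finset.sum_congr rfl fun j hj => ?_
  have hj := Finset.mem_range.1 hj
  rw [h _ (P.tag_mem_Icc hj) _ ⟨P.left_le_pt hj, P.pt_le_right hj⟩,
    h _ (P.tag_mem_Icc hj) _ ⟨P.left_le_pt hj.le, P.pt_le_right hj.le⟩]

theorem norm_sum_sub_le (P : TaggedPartition a b) {G : ℝ → ℝ → X} {F : ℝ → X} {μ : ℝ → ℝ}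
    (h : ∀ j < P.size, ‖G (P.tag j) (P.pt (j + 1)) - G (P.tag j) (P.pt j)
      - (F (P.pt (j + 1)) - F (P.pt j))‖ ≤ μ (P.pt (j + 1)) - μ (P.pt j)) :
    ‖P.sum G - (F b - F a)‖ ≤ μ b - μ a := by
  have h1 : F b - F a = ∑ j ∈ Finset.range P.size, (F (P.pt (j + 1)) - F (P.pt j)) := by
    rw [Finset.sum_range_sub (fun j => F (P.pt j)), P.pt_zero, P.pt_size]
  have h2 : μ b - μ a = ∑ j ∈ Finset.range P.size, (μ (P.pt (j + 1)) - μ (P.pt j)) := by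
    rw [Finset.sum_range_sub (fun j => μ (P.pt j)), P.pt_zero, P.pt_size]
  rw [h1, h2, TaggedPartition.sum, ← Finset.sum_sub_distrib]
  exact norm_sum_le_of_le _ fun j hj => h j (Finset.mem_range.1 hj)

/-- Concatenation of tagged partitions. -/
def append (P : TaggedPartition a b) (Q : TaggedPartition b c) : TaggedPartition a c where
  size := P.size + Q.size
  pt := fun j => if j < P.size then P.pt j else Q.pt (j - P.size)
  tag := fun j => if j < P.size then P.tag j else Q.tag (j - P.size)
  pt_zero := by
    split_ifs with h
    · exact P.pt_zero
    · have h0 : P.size = 0 := by omega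
      have := P.pt_size
      rw [h0, P.pt_zero] at this
      simp [Q.pt_zero, this]
  pt_size := by simp [Q.pt_size]
  pt_lt := by
    intro j hj
    rcases lt_trichotomy (j + 1) P.size with h | h | h
    · simpa [h, (Nat.lt_succ_self j).trans h] using P.pt_lt j (by omega)
    · have := P.pt_lt j (by omega)
      rw [h, P.pt_size] at this
      simpa [h, show j < P.size by omega, Q.pt_zero] using this
    · have := Q.pt_lt (j - P.size) (by omega)
      rw [show j - P.size + 1 = j + 1 - P.size by omega] at this
      simpa [show ¬ j < P.size by omega, show ¬ j + 1 < P.size by omega] using this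
  tag_mem := by
    intro j hj
    rcases lt_trichotomy (j + 1) P.size with h | h | h
    · simpa [h, (Nat.lt_succ_self j).trans h] using P.tag_mem j (by omega)
    · have := P.tag_mem j (by omega)
      rw [h, P.pt_size] at this
      simpa [h, show j < P.size by omega, Q.pt_zero] using this
    · have := Q.tag_mem (j - P.size) (by omega)
      rw [show j - P.size + 1 = j + 1 - P.size by omega] at this
      simpa [show ¬ j < P.size by omega, show ¬ j + 1 < P.size by omega] using this

theorem append_pt_left (P : TaggedPartition a b) (Q : TaggedPartition b c) {j : ℕ}
    (hj : j ≤ P.size) : (P.append Q).pt j = P.pt j := by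
  rcases hj.lt_or_eq with h | rfl
  · simp [append, h]
  · simp [append, P.pt_size, Q.pt_zero]

theorem append_pt_right (P : TaggedPartition a b) (Q : TaggedPartition b c) (j : ℕ) :
    (P.append Q).pt (P.size + j) = Q.pt j := by
  simp [append]

theorem append_tag_left (P : TaggedPartition a b) (Q : TaggedPartition b c) {j : ℕ}
    (hj : j < P.size) : (P.append Q).tag j = P.tag j := by
  simp [append, hj]

theorem append_tag_right (P : TaggedPartition a b) (Q : TaggedPartition b c) (j : ℕ) :
    (P.append Q).tag (P.size + j) = Q.tag j := by
  simp [append]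

theorem append_sum (P : TaggedPartition a b) (Q : TaggedPartition b c) (G : ℝ → ℝ → X) :
    (P.append Q).sum G = P.sum G + Q.sum G := by
  have h : (P.append Q).size = P.size + Q.size := rfl
  simp only [TaggedPartition.sum, h, Finset.sum_range_add]
  congr 1
  · refine Finset.sum_congr rfl fun j hj => ?_
    have hj := Finset.mem_range.1 hj
    rw [append_pt_left _ _ (by omega), append_pt_left _ _ (by omega), append_tag_left _ _ hj]
  · refine Finset.sum_congr rfl fun j _ => ?_
    rw [add_assoc, append_pt_right, append_pt_right, append_tag_right]

theorem IsFine.append {P : TaggedPartition a b} {Q : TaggedPartition b c} {δ : ℝ → ℝ}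
    (hP : P.IsFine δ) (hQ : Q.IsFine δ) : (P.append Q).IsFine δ := by
  intro j hj
  rcases lt_or_ge j P.size with h | h
  · rw [append_pt_left _ _ (by omega), append_pt_left _ _ (by omega), append_tag_left _ _ h]
    exact hP j h
  · obtain ⟨k, rfl⟩ := Nat.exists_eq_add_of_le h
    rw [add_assoc, append_pt_right, append_pt_right, append_tag_right]
    exact hQ k (Nat.lt_of_add_lt_add_left hj)

theorem IsFine.mono {P : TaggedPartition a b} {δ δ' : ℝ → ℝ} (hP : P.IsFine δ)
    (h : ∀ t, δ t ≤ δ' t) : P.IsFine δ' := fun j hj =>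
  (hP j hj).trans (Ioo_subset_Ioo (sub_le_sub_left (h _) _) (add_le_add_right (h _) _))

/-- The tagged partition with a single interval. -/
def single (hab : a < b) (τ : ℝ) (hτ : τ ∈ Icc a b) : TaggedPartition a b where
  size := 1
  pt := fun j => if j = 0 then a else b
  tag := fun _ => τ
  pt_zero := by simp
  pt_size := by simp
  pt_lt := by
    intro j hj
    obtain rfl : j = 0 := by omega
    simpa using hab
  tag_mem := by
    intro j hj
    obtain rfl : j = 0 := by omega
    simpa using hτ

theorem single_sum (hab : a < b) (τ : ℝ) (hτ : τ ∈ Icc a b) (G : ℝ → ℝ → X) :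
    (single hab τ hτ).sum G = G τ b - G τ a := by
  simp [TaggedPartition.sum, single]

theorem single_isFine (hab : a < b) (τ : ℝ) (hτ : τ ∈ Icc a b) {δ : ℝ → ℝ}
    (h1 : τ - δ τ < a) (h2 : b < τ + δ τ) : (single hab τ hτ).IsFine δ := by
  intro j hj
  obtain rfl : j = 0 := Nat.lt_one_iff.1 hj
  intro x hx
  simp only [single, if_true, Nat.zero_add, one_ne_zero, if_false] at hx ⊢
  exact ⟨h1.trans_le hx.1, hx.2.trans_lt h2⟩

end TaggedPartition

/-- A relation between the endpoints of subintervals of `[a, b]` that is reflexive, transitive and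
holds locally to the left and to the right of every point holds for `a` and `b`. -/
theorem interval_chain {a b : ℝ} (hab : a ≤ b) {R : ℝ → ℝ → Prop}
    (refl : ∀ c ∈ Icc a b, R c c)
    (trans : ∀ c m d, a ≤ c → c ≤ m → m ≤ d → d ≤ b → R c m → R m d → R c d)
    (loc : ∀ τ ∈ Icc a b, ∃ δ > 0, (∀ c, a ≤ c → τ - δ < c → c < τ → R c τ) ∧
      ∀ d ≤ b, τ < d → d < τ + δ → R τ d) : R a b := by
  choose! δ hδ hl hr using loc
  obtain ⟨P, hP⟩ := exists_isFine hab δ hδ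
  have key : ∀ j ≤ P.size, R a (P.pt j) := by
    intro j
    induction j with
    | zero => intro _; rw [P.pt_zero]; exact refl a ⟨le_rfl, hab⟩
    | succ k ih =>
      intro hk
      have hτ := P.tag_mem_Icc hk
      have hm := P.tag_mem k hk
      have hf := hP k hk
      have hlt := P.pt_lt k hk
      have hL := (hf ⟨le_rfl, hlt.le⟩).1
      have hR := (hf ⟨hlt.le, le_rfl⟩).2
      have ha := P.left_le_pt (Nat.le_of_succ_le hk)
      have hb := P.pt_le_right hk
      have h1 : R (P.pt k) (P.tag k) := by
        rcases hm.1.lt_or_eq with h | h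
        · exact hl _ hτ _ ha hL h
        · rw [← h]; exact refl _ ⟨ha, hlt.le.trans hb⟩
      have h2 : R (P.tag k) (P.pt (k + 1)) := by
        rcases hm.2.lt_or_eq with h | h
        · exact hr _ hτ _ hb h hR
        · rw [← h]; exact refl _ hτ
      exact trans _ _ _ le_rfl ha hlt.le hb (ih (Nat.le_of_succ_le hk))
        (trans _ _ _ ha hm.1 hm.2 hb h1 h2)
  simpa [P.pt_size] using key P.size le_rfl

/-- Near each point `τ` of `[a, b]`, the increments of `G τ` differ from those of `F` by at most
the increments of `μ`. -/
def LocallyApprox (G : ℝ → ℝ → X) (F : ℝ → X) (μ : ℝ → ℝ) (a b : ℝ) : Prop :=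
  ∀ τ ∈ Icc a b, ∃ δ > 0, ∀ p q, a ≤ p → p ≤ τ → τ ≤ q → q ≤ b → p < q → τ - δ < p → q < τ + δ →
    ‖G τ q - G τ p - (F q - F p)‖ ≤ μ q - μ p

theorem LocallyApprox.exists_gauge {G : ℝ → ℝ → X} {F : ℝ → X} {μ : ℝ → ℝ} {a b : ℝ}
    (h : LocallyApprox G F μ a b) : ∃ δ : ℝ → ℝ, (∀ t ∈ Icc a b, 0 < δ t) ∧
      ∀ P : TaggedPartition a b, P.IsFine δ → ‖P.sum G - (F b - F a)‖ ≤ μ b - μ a := by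
  choose! δ hδ H using h
  refine ⟨δ, hδ, fun P hP => P.norm_sum_sub_le fun j hj => ?_⟩
  have hm := P.tag_mem j hj
  have hlt := P.pt_lt j hj
  exact H _ (P.tag_mem_Icc hj) _ _ (P.left_le_pt hj.le) hm.1 hm.2 (P.pt_le_right hj) hlt
    (hP j hj ⟨le_rfl, hlt.le⟩).1 (hP j hj ⟨hlt.le, le_rfl⟩).2

theorem hasKurzweilIntegral_of_locallyApprox {G : ℝ → ℝ → X} {F : ℝ → X} {a b : ℝ}
    (h : ∀ ε > 0, ∃ μ : ℝ → ℝ, μ b - μ a < ε ∧ LocallyApprox G F μ a b) :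
    HasKurzweilIntegral G a b (F b - F a) := by
  intro ε hε
  obtain ⟨μ, hμ, hl⟩ := h ε hε
  obtain ⟨δ, hδ, H⟩ := hl.exists_gauge
  exact ⟨δ, hδ, fun P hP => (H P hP).trans_lt hμ⟩

theorem HasKurzweilIntegral.norm_sub_le_of_locallyApprox {G : ℝ → ℝ → X} {F : ℝ → X} {a b C : ℝ}
    (hab : a ≤ b) {J : X} (hJ : HasKurzweilIntegral G a b J)
    (h : ∀ η > 0, ∃ μ : ℝ → ℝ, μ b - μ a ≤ C + η ∧ LocallyApprox G F μ a b) :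
    ‖J - (F b - F a)‖ ≤ C := by
  refine le_of_forall_pos_le_add fun ε hε => ?_
  obtain ⟨μ, hμ, hl⟩ := h (ε / 2) (half_pos hε)
  obtain ⟨δ, hδ, H⟩ := hl.exists_gauge
  obtain ⟨δ', hδ', H'⟩ := hJ (ε / 2) (half_pos hε)
  obtain ⟨P, hP⟩ := exists_isFine hab (fun t => min (δ t) (δ' t))
    fun t ht => lt_min (hδ t ht) (hδ' t ht)
  have h1 := H P (hP.mono fun t => min_le_left _ _)
  have h2 := H' P (hP.mono fun t => min_le_right _ _)
  have h3 : J - (F b - F a) = (P.sum G - (F b - F a)) - (P.sum G - J) := by abel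
  rw [h3]
  linarith [norm_sub_le (P.sum G - (F b - F a)) (P.sum G - J)]

theorem HasKurzweilIntegral.norm_le_of_locallyApprox {G : ℝ → ℝ → X} {a b C : ℝ}
    (hab : a ≤ b) {J : X} (hJ : HasKurzweilIntegral G a b J)
    (h : ∀ η > 0, ∃ μ : ℝ → ℝ, μ b - μ a ≤ C + η ∧ LocallyApprox G (fun _ => 0) μ a b) :
    ‖J‖ ≤ C := by
  simpa using hJ.norm_sub_le_of_locallyApprox (F := fun _ => 0) hab h

theorem hasKurzweilIntegral_self (G : ℝ → ℝ → X) (a : ℝ) : HasKurzweilIntegral G a a 0 := by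
  simpa using hasKurzweilIntegral_of_locallyApprox (F := fun _ => (0 : X)) (G := G) (a := a) (b := a)
    fun ε hε => ⟨fun _ => 0, by simpa using hε, fun τ _ => ⟨1, one_pos, fun p q h1 _ _ h2 h3 => by
      linarith⟩⟩

theorem HasKurzweilIntegral.congr {G H : ℝ → ℝ → X} {a b : ℝ} {I : X}
    (hG : HasKurzweilIntegral G a b I) (h : ∀ τ ∈ Icc a b, ∀ t ∈ Icc a b, G τ t = H τ t) :
    HasKurzweilIntegral H a b I := by
  intro ε hε
  obtain ⟨δ, hδ, K⟩ := hG ε hε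
  exact ⟨δ, hδ, fun P hP => P.sum_congr h ▸ K P hP⟩

theorem HasKurzweilIntegral.add {G H : ℝ → ℝ → X} {a b : ℝ} {I J : X}
    (hG : HasKurzweilIntegral G a b I) (hH : HasKurzweilIntegral H a b J) :
    HasKurzweilIntegral (fun τ t => G τ t + H τ t) a b (I + J) := by
  intro ε hε
  obtain ⟨δ, hδ, K⟩ := hG (ε / 2) (half_pos hε)
  obtain ⟨δ', hδ', K'⟩ := hH (ε / 2) (half_pos hε)
  refine ⟨fun t => min (δ t) (δ' t), fun t ht => lt_min (hδ t ht) (hδ' t ht), fun P hP => ?_⟩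
  have h1 := K P (hP.mono fun t => min_le_left _ _)
  have h2 := K' P (hP.mono fun t => min_le_right _ _)
  rw [P.sum_add, add_sub_add_comm]
  linarith [norm_add_le (P.sum G - I) (P.sum H - J)]

theorem HasKurzweilIntegral.sub {G H : ℝ → ℝ → X} {a b : ℝ} {I J : X}
    (hG : HasKurzweilIntegral G a b I) (hH : HasKurzweilIntegral H a b J) :
    HasKurzweilIntegral (fun τ t => G τ t - H τ t) a b (I - J) := by
  intro ε hε
  obtain ⟨δ, hδ, K⟩ := hG (ε / 2) (half_pos hε)
  obtain ⟨δ', hδ', K'⟩ := hH (ε / 2) (half_pos hε)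
  refine ⟨fun t => min (δ t) (δ' t), fun t ht => lt_min (hδ t ht) (hδ' t ht), fun P hP => ?_⟩
  have h1 := K P (hP.mono fun t => min_le_left _ _)
  have h2 := K' P (hP.mono fun t => min_le_right _ _)
  rw [P.sum_sub, sub_sub_sub_comm]
  linarith [norm_sub_le (P.sum G - I) (P.sum H - J)]

theorem HasKurzweilIntegral.finset_sum {ι : Type*} (s : Finset ι) {G : ι → ℝ → ℝ → X} {a b : ℝ}
    {I : ι → X} (h : ∀ i ∈ s, HasKurzweilIntegral (G i) a b (I i)) :
    HasKurzweilIntegral (fun τ t => ∑ i ∈ s, G i τ t) a b (∑ i ∈ s, I i) := by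
  classical
  induction s using Finset.induction_on with
  | empty =>
    intro ε hε
    exact ⟨fun _ => 1, fun _ _ => one_pos, fun P _ => by simpa [TaggedPartition.sum] using hε⟩
  | insert i s his ih =>
    simp only [Finset.sum_insert his]
    exact (h i (Finset.mem_insert_self _ _)).add
      (ih fun j hj => h j (Finset.mem_insert_of_mem hj))

theorem HasKurzweilIntegral.map [NormedSpace ℝ X] [NormedSpace ℝ Y] (L : X →L[ℝ] Y)
    {G : ℝ → ℝ → X} {a b : ℝ} {I : X} (hG : HasKurzweilIntegral G a b I) :
    HasKurzweilIntegral (fun τ t => L (G τ t)) a b (L I) := by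
  intro ε hε
  have hpos : 0 < ‖L‖ + 1 := by positivity
  obtain ⟨δ, hδ, K⟩ := hG (ε / (‖L‖ + 1)) (by positivity)
  refine ⟨δ, hδ, fun P hP => ?_⟩
  have h1 : P.sum (fun τ t => L (G τ t)) = L (P.sum G) := by
    simp [TaggedPartition.sum, map_sum]
  rw [h1, ← map_sub]
  calc ‖L (P.sum G - I)‖ ≤ ‖L‖ * ‖P.sum G - I‖ := L.le_opNorm _
    _ ≤ (‖L‖ + 1) * ‖P.sum G - I‖ := by gcongr; linarith
    _ < (‖L‖ + 1) * (ε / (‖L‖ + 1)) := by gcongr; exact K P hP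
    _ = ε := by field_simp

/-- The Cauchy criterion for Kurzweil integrability. -/
theorem kurzweilIntegrable_of_cauchy [CompleteSpace X] {G : ℝ → ℝ → X} {a b : ℝ} (hab : a ≤ b)
    (h : ∀ ε > 0, ∃ δ : ℝ → ℝ, (∀ t ∈ Icc a b, 0 < δ t) ∧
      ∀ P Q : TaggedPartition a b, P.IsFine δ → Q.IsFine δ → ‖P.sum G - Q.sum G‖ ≤ ε) :
    KurzweilIntegrable G a b := by
  choose! δ hδ H using h
  let e : ℕ → ℝ := fun n => 1 / ((n : ℝ) + 1)
  have he : ∀ n, 0 < e n := fun n => Nat.one_div_pos_of_nat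
  -- The gauges `δ (e k)` need not be nested; the minimum of the first `n + 1` of them makes `P n`
  -- fine for all of them at once.
  let γ : ℕ → ℝ → ℝ := fun n t => (Finset.range (n + 1)).inf' ⟨0, by simp⟩ fun k => δ (e k) t
  have hγ : ∀ n, ∀ t ∈ Icc a b, 0 < γ n t := fun n t ht =>
    (Finset.lt_inf'_iff _).2 fun k _ => hδ _ (he k) t ht
  have hγle : ∀ n k, k ≤ n → ∀ t, γ n t ≤ δ (e k) t := fun n k hk t =>
    Finset.inf'_le (fun k => δ (e k) t) (Finset.mem_range.2 (Nat.lt_succ_of_le hk))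
  choose P hP using fun n => exists_isFine hab (γ n) (hγ n)
  have hdist : ∀ n m k, k ≤ n → k ≤ m → ‖(P n).sum G - (P m).sum G‖ ≤ e k := fun n m k hn hm =>
    H _ (he k) _ _ ((hP n).mono (hγle n k hn)) ((hP m).mono (hγle m k hm))
  have hlim : Tendsto e atTop (𝓝 0) := tendsto_one_div_add_atTop_nhds_zero_nat
  have hcau : CauchySeq fun n => (P n).sum G :=
    cauchySeq_of_le_tendsto_0 e (fun n m N hn hm => by
      rw [dist_eq_norm]; exact hdist n m N hn hm) hlim
  obtain ⟨I, hI⟩ := cauchySeq_tendsto_of_complete hcau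
  refine ⟨I, fun ε hε => ?_⟩
  obtain ⟨k, hk⟩ := (hlim.eventually (gt_mem_nhds (half_pos hε))).exists
  have hkI : ‖(P k).sum G - I‖ ≤ e k := by
    have : Tendsto (fun m => ‖(P k).sum G - (P m).sum G‖) atTop (𝓝 ‖(P k).sum G - I‖) :=
      (tendsto_const_nhds.sub hI).norm
    exact le_of_tendsto this ((eventually_ge_atTop k).mono fun m hm => hdist k m k le_rfl hm)
  refine ⟨δ (e k), hδ _ (he k), fun Q hQ => ?_⟩
  have h1 := H _ (he k) Q (P k) hQ ((hP k).mono (hγle k k le_rfl))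
  have h2 := norm_add_le (Q.sum G - (P k).sum G) ((P k).sum G - I)
  rw [sub_add_sub_cancel] at h2
  linarith

/-- A uniform limit, in the sense of the sums, of integrable functions is integrable. -/
theorem kurzweilIntegrable_of_approx [CompleteSpace X] {G : ℝ → ℝ → X} {a b : ℝ} (hab : a ≤ b)
    (h : ∀ ε > 0, ∃ H : ℝ → ℝ → X, KurzweilIntegrable H a b ∧
      ∀ P : TaggedPartition a b, ‖P.sum G - P.sum H‖ ≤ ε) : KurzweilIntegrable G a b := by
  refine kurzweilIntegrable_of_cauchy hab fun ε hε => ?_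
  obtain ⟨H, ⟨I, hI⟩, hH⟩ := h (ε / 4) (by positivity)
  obtain ⟨δ, hδ, K⟩ := hI (ε / 4) (by positivity)
  refine ⟨δ, hδ, fun P Q hP hQ => ?_⟩
  have e : P.sum G - Q.sum G = (P.sum G - P.sum H) + (P.sum H - I) - (Q.sum H - I)
      - (Q.sum G - Q.sum H) := by abel
  rw [e]
  have h1 := norm_sub_le ((P.sum G - P.sum H) + (P.sum H - I) - (Q.sum H - I)) (Q.sum G - Q.sum H)
  have h2 := norm_sub_le ((P.sum G - P.sum H) + (P.sum H - I)) (Q.sum H - I)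
  have h3 := norm_add_le (P.sum G - P.sum H) (P.sum H - I)
  linarith [hH P, hH Q, K P hP, K Q hQ]

theorem hasKurzweilIntegral_of_approx {G : ℝ → ℝ → X} {a b : ℝ} {I : X}
    (h : ∀ ε > 0, ∃ (H : ℝ → ℝ → X) (J : X), HasKurzweilIntegral H a b J ∧ ‖J - I‖ ≤ ε ∧
      ∀ P : TaggedPartition a b, ‖P.sum G - P.sum H‖ ≤ ε) : HasKurzweilIntegral G a b I := by
  intro ε hε
  obtain ⟨H, J, hJ, hJI, hH⟩ := h (ε / 4) (by positivity)
  obtain ⟨δ, hδ, K⟩ := hJ (ε / 4) (by positivity)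
  refine ⟨δ, hδ, fun P hP => ?_⟩
  have e : P.sum G - I = (P.sum G - P.sum H) + (P.sum H - J) + (J - I) := by abel
  rw [e]
  have h2 := norm_add_le ((P.sum G - P.sum H) + (P.sum H - J)) (J - I)
  have h3 := norm_add_le (P.sum G - P.sum H) (P.sum H - J)
  linarith [hH P, K P hP]

/-- Integrability is inherited by the two parts of a subdivided interval, and the integral is
additive. -/
theorem HasKurzweilIntegral.exists_split [CompleteSpace X] {G : ℝ → ℝ → X} {a b c : ℝ}
    (hab : a ≤ b) (hbc : b ≤ c) {I : X} (hI : HasKurzweilIntegral G a c I) :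
    ∃ J K, HasKurzweilIntegral G a b J ∧ HasKurzweilIntegral G b c K ∧ J + K = I := by
  have h1 : KurzweilIntegrable G a b := kurzweilIntegrable_of_cauchy hab fun ε hε => by
    obtain ⟨δ, hδ, H⟩ := hI (ε / 2) (half_pos hε)
    -- Completing two partitions of `[a, b]` by the same `R` turns them into partitions of `[a, c]`,
    -- and the contribution of `R` cancels in the difference.
    obtain ⟨R, hR⟩ := exists_isFine hbc δ fun t ht => hδ t ⟨hab.trans ht.1, ht.2⟩
    refine ⟨δ, fun t ht => hδ t ⟨ht.1, ht.2.trans hbc⟩, fun P Q hP hQ => ?_⟩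
    have hp := H _ (hP.append hR)
    have hq := H _ (hQ.append hR)
    rw [TaggedPartition.append_sum] at hp hq
    have := norm_sub_le (P.sum G + R.sum G - I) (Q.sum G + R.sum G - I)
    rw [show P.sum G + R.sum G - I - (Q.sum G + R.sum G - I) = P.sum G - Q.sum G by abel] at this
    linarith
  have h2 : KurzweilIntegrable G b c := kurzweilIntegrable_of_cauchy hbc fun ε hε => by
    obtain ⟨δ, hδ, H⟩ := hI (ε / 2) (half_pos hε)
    obtain ⟨R, hR⟩ := exists_isFine hab δ fun t ht => hδ t ⟨ht.1, ht.2.trans hbc⟩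
    refine ⟨δ, fun t ht => hδ t ⟨hab.trans ht.1, ht.2⟩, fun P Q hP hQ => ?_⟩
    have hp := H _ (hR.append hP)
    have hq := H _ (hR.append hQ)
    rw [TaggedPartition.append_sum] at hp hq
    have := norm_sub_le (R.sum G + P.sum G - I) (R.sum G + Q.sum G - I)
    rw [show R.sum G + P.sum G - I - (R.sum G + Q.sum G - I) = P.sum G - Q.sum G by abel] at this
    linarith
  obtain ⟨J, hJ⟩ := h1
  obtain ⟨K, hK⟩ := h2
  refine ⟨J, K, hJ, hK, ?_⟩
  refine eq_of_forall_dist_le fun ε hε => ?_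
  obtain ⟨δ, hδ, H⟩ := hI (ε / 3) (by positivity)
  obtain ⟨δ₁, hδ₁, H₁⟩ := hJ (ε / 3) (by positivity)
  obtain ⟨δ₂, hδ₂, H₂⟩ := hK (ε / 3) (by positivity)
  obtain ⟨P, hP⟩ := exists_isFine hab (fun t => min (δ t) (δ₁ t)) fun t ht =>
    lt_min (hδ t ⟨ht.1, ht.2.trans hbc⟩) (hδ₁ t ht)
  obtain ⟨Q, hQ⟩ := exists_isFine hbc (fun t => min (δ t) (δ₂ t)) fun t ht =>
    lt_min (hδ t ⟨hab.trans ht.1, ht.2⟩) (hδ₂ t ht)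
  have k := H _ ((hP.mono fun t => min_le_left _ _).append (hQ.mono fun t => min_le_left _ _))
  have k₁ := H₁ _ (hP.mono fun t => min_le_right _ _)
  have k₂ := H₂ _ (hQ.mono fun t => min_le_right _ _)
  rw [TaggedPartition.append_sum] at k
  rw [dist_eq_norm, show J + K - I = (P.sum G + Q.sum G - I) - (P.sum G - J) - (Q.sum G - K) by abel]
  have e1 := norm_sub_le ((P.sum G + Q.sum G - I) - (P.sum G - J)) (Q.sum G - K)
  have e2 := norm_sub_le (P.sum G + Q.sum G - I) (P.sum G - J)
  linarith

/-- The Saks–Henstock lemma for a single interval. -/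
theorem saksHenstock_single {G : ℝ → ℝ → X} {F : ℝ → X} {a b : ℝ}
    (hF : ∀ c d, a ≤ c → c ≤ d → d ≤ b → HasKurzweilIntegral G c d (F d - F c)) {ε : ℝ}
    (hε : 0 < ε) {τ : ℝ} (hτ : τ ∈ Icc a b) :
    ∃ δ > 0, ∀ p q, a ≤ p → p ≤ τ → τ ≤ q → q ≤ b → p < q → τ - δ < p → q < τ + δ →
      ‖G τ q - G τ p - (F q - F p)‖ ≤ ε := by
  obtain ⟨δ, hδ, H⟩ := hF a b le_rfl (hτ.1.trans hτ.2) le_rfl ε hε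
  refine ⟨δ τ, hδ τ hτ, fun p q hap hpτ hτq hqb hpq h1 h2 => ?_⟩
  refine le_of_forall_pos_le_add fun η hη => ?_
  -- The rest of `[a, b]` is filled with partitions whose sums are `η / 2`-close to the true
  -- integrals, so up to `η` the error `ε` bounds the single interval alone.
  obtain ⟨δ₁, hδ₁, H₁⟩ := hF a p le_rfl hap (hpq.le.trans hqb) (η / 2) (half_pos hη)
  obtain ⟨δ₂, hδ₂, H₂⟩ := hF q b (hap.trans hpq.le) hqb le_rfl (η / 2) (half_pos hη)
  obtain ⟨P, hP⟩ := exists_isFine hap (fun t => min (δ t) (δ₁ t)) fun t ht =>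
    lt_min (hδ t ⟨ht.1, ht.2.trans (hpq.le.trans hqb)⟩) (hδ₁ t ht)
  obtain ⟨Q, hQ⟩ := exists_isFine hqb (fun t => min (δ t) (δ₂ t)) fun t ht =>
    lt_min (hδ t ⟨(hap.trans hpq.le).trans ht.1, ht.2⟩) (hδ₂ t ht)
  have hτ' : τ ∈ Icc p q := ⟨hpτ, hτq⟩
  have k := H _ (((hP.mono fun t => min_le_left _ _).append
    (TaggedPartition.single_isFine hpq τ hτ' h1 h2)).append
    (hQ.mono fun t => min_le_left _ _))
  have k₁ := H₁ _ (hP.mono fun t => min_le_right _ _)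
  have k₂ := H₂ _ (hQ.mono fun t => min_le_right _ _)
  rw [TaggedPartition.append_sum, TaggedPartition.append_sum, TaggedPartition.single_sum] at k
  rw [show G τ q - G τ p - (F q - F p) = (P.sum G + (G τ q - G τ p) + Q.sum G - (F b - F a))
    - (P.sum G - (F p - F a)) - (Q.sum G - (F b - F q)) by abel]
  have e1 := norm_sub_le ((P.sum G + (G τ q - G τ p) + Q.sum G - (F b - F a))
    - (P.sum G - (F p - F a))) (Q.sum G - (F b - F q))
  have e2 := norm_sub_le (P.sum G + (G τ q - G τ p) + Q.sum G - (F b - F a))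
    (P.sum G - (F p - F a))
  linarith

end KurzweilBasics

/-! ### Monotone left-continuous majorants of functions of bounded variation. -/

section Control

variable {X : Type*} [NormedAddCommGroup X]

/-- `v` is a monotone left-continuous function that dominates the increments of `f` on
`[a, ∞)`. -/
structure IsControl (v : ℝ → ℝ) (f : ℝ → X) (a : ℝ) : Prop where
  mono : Monotone v
  leftCont : ∀ t, ContinuousWithinAt v (Iio t) t
  norm_le : ∀ c d, a ≤ c → c ≤ d → ‖f d - f c‖ ≤ v d - v c

theorem IsControl.mono_left {v : ℝ → ℝ} {f : ℝ → X} {a b : ℝ} (h : IsControl v f a)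
    (hab : a ≤ b) : IsControl v f b :=
  ⟨h.mono, h.leftCont, fun c d hc => h.norm_le c d (hab.trans hc)⟩

theorem norm_sub_le_variationOnFromTo {f : ℝ → X} {s : Set ℝ}
    (hf : LocallyBoundedVariationOn f s) {a c d : ℝ} (ha : a ∈ s) (hc : c ∈ s) (hd : d ∈ s)
    (hcd : c ≤ d) : ‖f d - f c‖ ≤ variationOnFromTo f s a d - variationOnFromTo f s a c := by
  have h1 := variationOnFromTo.add hf ha hc hd
  have h2 : ‖f d - f c‖ ≤ variationOnFromTo f s c d := by
    rw [variationOnFromTo.eq_of_le f _ hcd, ← dist_eq_norm, dist_edist]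
    exact ENNReal.toReal_mono (hf _ _ hc hd)
      (eVariationOn.edist_le f ⟨hd, hcd, le_rfl⟩ ⟨hc, le_rfl, hcd⟩)
  linarith

/-- The majorant is the left limit of the variation function. Left-continuity of the variation
function itself need not be proved: the inequality for increments passes to left limits at both
endpoints, because `f` is left-continuous. Freezing `f` to the left of `a` makes this work at `a`
too. -/
theorem exists_isControl {f : ℝ → X} {a : ℝ} (hf : LocallyBoundedVariationOn f (Ici a))
    (hl : ∀ t > a, ContinuousWithinAt f (Iio t) t) : ∃ v, IsControl v f a := by
  set g : ℝ → X := fun t => f (max a t) with hg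
  set v₁ : ℝ → ℝ := fun t => variationOnFromTo f (Ici a) a (max a t) with hv₁
  have hmono : Monotone v₁ := fun s t hst =>
    variationOnFromTo.monotoneOn hf (mem_Ici.2 le_rfl) (le_max_left a s) (le_max_left a t)
      (max_le_max le_rfl hst)
  have hdom : ∀ c d, c ≤ d → ‖g d - g c‖ ≤ v₁ d - v₁ c := by
    intro c d hcd
    exact norm_sub_le_variationOnFromTo hf (mem_Ici.2 (le_refl a)) (le_max_left a c)
      (le_max_left a d) (max_le_max le_rfl hcd)
  have hgl : ∀ t, Tendsto g (𝓝[<] t) (𝓝 (g t)) := by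
    intro t
    rcases le_or_gt t a with h | h
    · have : g =ᶠ[𝓝[<] t] fun _ => g t := by
        filter_upwards [self_mem_nhdsWithin] with s hs
        simp only [hg, max_eq_left h, max_eq_left ((mem_Iio.1 hs).le.trans h)]
      exact (tendsto_congr' this).2 tendsto_const_nhds
    · have : f =ᶠ[𝓝[<] t] g := by
        filter_upwards [nhdsWithin_le_nhds (lt_mem_nhds h)] with s hs
        simp only [hg, max_eq_right hs.le]
      have h2 : g t = f t := by simp only [hg, max_eq_right h.le]
      rw [h2]
      exact (hl t h).congr' this
  refine ⟨Function.leftLim v₁, hmono.leftLim, fun t => ?_, fun c d hc hcd => ?_⟩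
  · rw [hmono.leftLim.continuousWithinAt_Iio_iff_leftLim_eq]
    exact leftLim_leftLim (hmono.tendsto_leftLim t)
  · have hfc : f c = g c := by simp only [hg, max_eq_right hc]
    have hfd : f d = g d := by simp only [hg, max_eq_right (hc.trans hcd)]
    rw [hfc, hfd]
    have key : ∀ s < c, ‖g d - g s‖ ≤ Function.leftLim v₁ d - v₁ s := by
      intro s hs
      have t1 : Tendsto (fun r => ‖g r - g s‖) (𝓝[<] d) (𝓝 ‖g d - g s‖) :=
        ((hgl d).sub tendsto_const_nhds).norm
      have t2 : Tendsto (fun r => v₁ r - v₁ s) (𝓝[<] d) (𝓝 (Function.leftLim v₁ d - v₁ s)) :=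
        (hmono.tendsto_leftLim d).sub tendsto_const_nhds
      refine le_of_tendsto_of_tendsto t1 t2 ?_
      filter_upwards [nhdsWithin_le_nhds (lt_mem_nhds (hs.trans_le hcd))] with r hr
      exact hdom s r hr.le
    have t1 : Tendsto (fun s => ‖g d - g s‖) (𝓝[<] c) (𝓝 ‖g d - g c‖) :=
      (tendsto_const_nhds.sub (hgl c)).norm
    have t2 : Tendsto (fun s => Function.leftLim v₁ d - v₁ s) (𝓝[<] c)
        (𝓝 (Function.leftLim v₁ d - Function.leftLim v₁ c)) :=
      tendsto_const_nhds.sub (hmono.tendsto_leftLim c)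
    refine le_of_tendsto_of_tendsto t1 t2 ?_
    filter_upwards [self_mem_nhdsWithin] with s hs
    exact key s hs

/-- A monotone left-continuous function varies little just to the left of a point. -/
theorem exists_left_small {v : ℝ → ℝ} (hl : ∀ t, ContinuousWithinAt v (Iio t) t) (τ : ℝ) {ε : ℝ}
    (hε : 0 < ε) : ∃ δ > 0, ∀ p, p ≤ τ → τ - δ < p → v τ - v p < ε := by
  have h := (hl τ).eventually (lt_mem_nhds (sub_lt_self (v τ) hε))
  obtain ⟨l, hlτ, hsub⟩ := mem_nhdsLT_iff_exists_Ioo_subset.1 h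
  refine ⟨τ - l, sub_pos.2 hlτ, fun p hp hp' => ?_⟩
  rcases hp.lt_or_eq with h | rfl
  · have := hsub ⟨by linarith, h⟩
    simp only [mem_ofPred_eq] at this
    linarith
  · simpa using hε

theorem exists_right_small {v : ℝ → ℝ} (hv : Monotone v) (τ : ℝ) {ε : ℝ}
    (hε : 0 < ε) : ∃ δ > 0, ∀ q, τ < q → q < τ + δ → v q - Function.rightLim v τ < ε := by
  have h := (hv.tendsto_rightLim τ).eventually
    (gt_mem_nhds (lt_add_of_pos_right (Function.rightLim v τ) hε))
  obtain ⟨u, hu, hsub⟩ := mem_nhdsGT_iff_exists_Ioo_subset.1 h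
  refine ⟨u - τ, sub_pos.2 hu, fun q hq hq' => ?_⟩
  have := hsub ⟨hq, by linarith⟩
  simp only [mem_ofPred_eq] at this
  linarith

/-- Increments of `v` vanish just to the right of `t`, so `f` is Cauchy there. The bound measures
the distance to the limit by `v` without its jump at `t`. -/
theorem IsControl.exists_right_limit [CompleteSpace X] {v : ℝ → ℝ} {f : ℝ → X} {a : ℝ}
    (h : IsControl v f a) {t : ℝ} (ht : a ≤ t) :
    ∃ L, Tendsto f (𝓝[>] t) (𝓝 L) ∧ ∀ d > t, ‖f d - L‖ ≤ v d - Function.rightLim v t := by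
  have hc : Cauchy (map f (𝓝[>] t)) := by
    rw [Metric.cauchy_iff]
    refine ⟨inferInstance, fun ε hε => ?_⟩
    obtain ⟨δ, hδ, H⟩ := exists_right_small h.mono t hε
    refine ⟨f '' Ioo t (t + δ), image_mem_map (Ioo_mem_nhdsGT (by linarith)), ?_⟩
    have key : ∀ x ∈ Ioo t (t + δ), ∀ y ∈ Ioo t (t + δ), x ≤ y → dist (f y) (f x) < ε := by
      intro x hx y hy hxy
      rw [dist_eq_norm]
      have h1 := h.norm_le x y (ht.trans hx.1.le) hxy
      have h2 := H y hy.1 hy.2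
      have h3 := h.mono.rightLim_le hx.1
      linarith
    rintro _ ⟨x, hx, rfl⟩ _ ⟨y, hy, rfl⟩
    rcases le_total x y with hxy | hxy
    · rw [dist_comm]; exact key x hx y hy hxy
    · exact key y hy x hx hxy
  obtain ⟨L, hL⟩ := CompleteSpace.complete hc
  have hL : Tendsto f (𝓝[>] t) (𝓝 L) := hL
  refine ⟨L, hL, fun d hd => ?_⟩
  have t1 : Tendsto (fun s => ‖f d - f s‖) (𝓝[>] t) (𝓝 ‖f d - L‖) :=
    (tendsto_const_nhds.sub hL).norm
  have t2 : Tendsto (fun s => v d - v s) (𝓝[>] t) (𝓝 (v d - Function.rightLim v t)) :=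
    tendsto_const_nhds.sub (h.mono.tendsto_rightLim t)
  refine le_of_tendsto_of_tendsto t1 t2 ?_
  filter_upwards [Ioo_mem_nhdsGT hd] with s hs
  exact h.norm_le s d (ht.trans hs.1.le) hs.2.le

/-- Left-continuity puts the supremum `r` of the sublevel set into that set, so the superlevel set
is an open half-line. -/
theorem exists_cut {w : ℝ → ℝ} (hw : Monotone w) (hl : ∀ t, ContinuousWithinAt w (Iio t) t)
    {a b l : ℝ} (ha : w a ≤ l) (hb : l < w b) : ∃ r, a ≤ r ∧ r < b ∧ ∀ t, l < w t ↔ r < t := by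
  have hab : a < b := by
    by_contra hba
    exact absurd (hw (not_lt.1 hba)) (by linarith)
  have hbdd : BddAbove {t | w t ≤ l} := ⟨b, fun t ht => by
    by_contra hbt
    have : w b ≤ w t := hw (not_le.1 hbt).le
    have : w t ≤ l := ht
    linarith⟩
  set r := sSup {t | w t ≤ l} with hr
  have har : a ≤ r := le_csSup hbdd ha
  have hlt : ∀ s < r, w s ≤ l := by
    intro s hs
    obtain ⟨u, hu, hsu⟩ := exists_lt_of_lt_csSup ⟨a, ha⟩ hs
    exact (hw hsu.le).trans hu
  have hwr : w r ≤ l := le_of_tendsto (hl r) (by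
    filter_upwards [self_mem_nhdsWithin] with s hs using hlt s hs)
  have key : ∀ t, l < w t ↔ r < t := by
    intro t
    constructor
    · intro h
      by_contra hc
      linarith [hw (not_lt.1 hc)]
    · intro h
      by_contra hc
      exact absurd (le_csSup hbdd (not_lt.1 hc)) (not_le.2 h)
  exact ⟨r, har, (key b).1 hb, key⟩

theorem hasKurzweilIntegral_const (f : ℝ → X) (a b : ℝ) :
    HasKurzweilIntegral (fun _ t => f t) a b (f b - f a) :=
  hasKurzweilIntegral_of_locallyApprox fun ε hε => ⟨fun _ => 0, by simpa using hε,
    fun τ _ => ⟨1, one_pos, fun p q _ _ _ _ _ _ _ => by simp⟩⟩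

/-- Superlevel sets of monotone left-continuous functions are integrable against controlled
functions. -/
theorem IsControl.integrable_superlevel [CompleteSpace X] {v w : ℝ → ℝ} {f : ℝ → X} {a b : ℝ}
    (h : IsControl v f a) (hw : Monotone w) (hl : ∀ t, ContinuousWithinAt w (Iio t) t) (l : ℝ) :
    KurzweilIntegrable (fun τ t => if l < w τ then f t else 0) a b := by
  rcases le_or_gt (w b) l with hb | hb
  · refine ⟨0, ?_⟩
    have := hasKurzweilIntegral_const (fun _ => (0 : X)) a b
    rw [sub_zero] at this
    exact this.congr fun τ hτ t _ => (if_neg (not_lt.2 ((hw hτ.2).trans hb))).symm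
  rcases lt_or_ge l (w a) with ha | ha
  · exact ⟨_, (hasKurzweilIntegral_const f a b).congr fun τ hτ t _ =>
      (if_pos (ha.trans_le (hw hτ.1))).symm⟩
  obtain ⟨r, har, hrb, hr⟩ := exists_cut hw hl ha hb
  obtain ⟨L, -, hL⟩ := h.exists_right_limit har
  simp only [hr]
  -- The indefinite integral is `f t - L` beyond `r`, with `L` the right limit of `f` at `r`. Only
  -- intervals tagged at `r` leave an error, and it is paid for by the jump `ε / 2` of `μ` at `r`.
  refine ⟨_, hasKurzweilIntegral_of_locallyApprox (F := fun t => if r < t then f t - L else 0)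
    fun ε hε => ⟨fun t => if r < t then ε / 2 else 0, by simp [hrb, not_lt.2 har]; linarith, ?_⟩⟩
  intro τ hτ
  rcases lt_trichotomy τ r with hτr | rfl | hτr
  · refine ⟨r - τ, by linarith, fun p q _ hpτ _ _ _ _ hq => ?_⟩
    simp [show ¬ r < τ by linarith, show ¬ r < p by linarith, show ¬ r < q by linarith]
  · obtain ⟨δ, hδ, H⟩ := exists_right_small h.mono τ (half_pos hε)
    refine ⟨δ, hδ, fun p q _ hpτ hτq _ _ _ hq => ?_⟩
    rcases hτq.lt_or_eq with hlt | rfl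
    · simp only [lt_self_iff_false, if_false, hlt, if_true, not_lt.2 hpτ, sub_zero, zero_sub,
        norm_neg]
      linarith [hL q hlt, H q hlt hq]
    · simp [not_lt.2 hpτ]
  · refine ⟨τ - r, by linarith, fun p q _ _ hτq _ _ hp _ => ?_⟩
    simp [hτr, show r < p by linarith, show r < q by linarith]

end Control

/-! ### Existence of the Stieltjes integral. -/

section Integrability

variable {F X : Type*} [NormedAddCommGroup F] [NormedSpace ℝ F] [NormedAddCommGroup X]
  [NormedSpace ℝ X]

theorem IsControl.apply {v : ℝ → ℝ} {B : ℝ → F →L[ℝ] X} {a : ℝ} (h : IsControl v B a) (e : F) :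
    IsControl (fun t => ‖e‖ * v t) (fun t => B t e) a := by
  refine ⟨h.mono.const_mul (norm_nonneg e), fun t => (h.leftCont t).const_mul _,
    fun c d hc hcd => ?_⟩
  rw [← sub_apply, ← mul_sub, mul_comm]
  exact (B d - B c).le_of_opNorm_le (h.norm_le c d hc hcd) e

/-- `∫_a^b d[B(t)] y(t)` exists if `B` and `y` are of bounded variation and left-continuous. -/
theorem IsControl.kurzweilIntegrable [CompleteSpace X] {v w : ℝ → ℝ} {B : ℝ → F →L[ℝ] X}
    {y : ℝ → F} {a b : ℝ} (hB : IsControl v B a) (hy : IsControl w y a) (hab : a ≤ b) :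
    KurzweilIntegrable (fun τ t => B t (y τ)) a b := by
  refine kurzweilIntegrable_of_approx hab fun ε hε => ?_
  have hvab : 0 ≤ v b - v a := sub_nonneg.2 (hB.mono hab)
  set h : ℝ := ε / (v b - v a + 1) with hh
  have hpos : 0 < h := by positivity
  -- Cutting the range of `w` into levels of height `h` cuts `[a, b]` into finitely many pieces on
  -- which `y` oscillates by at most `h`. Replacing `y` by one value per level changes any sum by at
  -- most `h * (v b - v a) ≤ ε`.
  set k : ℝ → ℕ := fun τ => ⌈(w τ - w a) / h⌉₊ with hk
  have hklt : ∀ j τ, j < k τ ↔ w a + j * h < w τ := by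
    intro j τ
    rw [hk, Nat.lt_ceil, lt_div_iff₀ hpos, lt_sub_iff_add_lt']
  have hosc : ∀ s τ, a ≤ s → s ≤ τ → k s = k τ → ‖y τ - y s‖ ≤ h := by
    intro s τ has hsτ hkk
    refine (hy.norm_le s τ has hsτ).trans ?_
    have hwa : w a ≤ w s := hy.mono has
    rcases Nat.eq_zero_or_pos (k τ) with h0 | h0
    · have := mt (hklt 0 τ).2 (by omega)
      simp only [Nat.cast_zero, zero_mul, add_zero, not_lt] at this
      linarith
    · have h1 := (hklt (k τ - 1) s).1 (by omega)
      have h2 := mt (hklt (k τ) τ).2 (lt_irrefl _)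
      rw [Nat.cast_sub h0, Nat.cast_one] at h1
      nlinarith
  have hrep : ∀ n : ℕ, ∃ e : F, ∀ τ, a ≤ τ → k τ = n → ‖y τ - e‖ ≤ h := by
    intro n
    by_cases hn : ∃ s, a ≤ s ∧ k s = n
    · obtain ⟨s, hs, rfl⟩ := hn
      refine ⟨y s, fun τ hτ hkτ => ?_⟩
      rcases le_total s τ with hle | hle
      · exact hosc s τ hs hle hkτ.symm
      · rw [norm_sub_rev]; exact hosc τ s hτ hle hkτ
    · exact ⟨0, fun τ hτ hkτ => absurd ⟨τ, hτ, hkτ⟩ hn⟩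
  choose e he using hrep
  refine ⟨fun τ t => B t (e (k τ)), ?_, fun P => ?_⟩
  -- Summation by parts: the step function is `e 0` plus the increments `e (j + 1) - e j` on the
  -- superlevel sets of `w`.
  · have hj : ∀ j : ℕ, KurzweilIntegrable
        (fun τ t => if w a + j * h < w τ then B t (e (j + 1) - e j) else 0) a b :=
      fun j => (hB.apply _).integrable_superlevel hy.mono hy.leftCont _
    choose I hI using hj
    refine ⟨_, ((hasKurzweilIntegral_const (fun t => B t (e 0)) a b).add
      (HasKurzweilIntegral.finset_sum (Finset.range (k b)) fun j _ => hI j)).congr ?_⟩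
    intro τ hτ t _
    have hkb : k τ ≤ k b := Nat.ceil_mono (by
      have := hy.mono hτ.2
      gcongr)
    simp only [← hklt, map_sub]
    rw [← Finset.sum_filter]
    have : (Finset.range (k b)).filter (fun j => j < k τ) = Finset.range (k τ) := by
      ext j
      simp only [Finset.mem_filter, Finset.mem_range]
      omega
    rw [this, Finset.sum_range_sub (fun j => B t (e j))]
    abel
  · rw [← P.sum_sub]
    have := P.norm_sum_sub_le (G := fun τ t => B t (y τ) - B t (e (k τ))) (F := fun _ => 0)
      (μ := fun t => h * v t) (fun j hj => ?_)
    · simp only [sub_zero] at this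
      refine this.trans ?_
      rw [← mul_sub, hh, div_mul_eq_mul_div, div_le_iff₀ (by positivity)]
      nlinarith
    · have hp := P.left_le_pt hj.le
      have hlt := P.pt_lt j hj
      have hm := P.tag_mem j hj
      have h1 := hB.norm_le _ _ hp hlt.le
      have h2 := he _ (P.tag j) (hp.trans hm.1) rfl
      rw [sub_self, sub_zero, ← map_sub, ← map_sub, ← sub_apply, ← mul_sub,
        mul_comm]
      exact ((B _ - B _).le_opNorm _).trans
        (by gcongr; exact sub_nonneg.2 (hB.mono hlt.le))

end Integrability

/-! ### Integral estimates; existence and uniqueness of forward solutions. -/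

section LinearEquation

variable {F X : Type*} [NormedAddCommGroup F] [NormedSpace ℝ F] [NormedAddCommGroup X]
  [NormedSpace ℝ X]

theorem IsControl.norm_apply_sub_le {v : ℝ → ℝ} {B : ℝ → F →L[ℝ] X} {a : ℝ}
    (hB : IsControl v B a) {p q M : ℝ} (hap : a ≤ p) (hpq : p ≤ q) {e : F} (he : ‖e‖ ≤ M) :
    ‖B q e - B p e‖ ≤ (v q - v p) * M := by
  rw [← sub_apply]
  have h1 := hB.norm_le p q hap hpq
  have h0 : 0 ≤ v q - v p := sub_nonneg.2 (hB.mono hpq)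
  exact ((B q - B p).le_opNorm e).trans (by gcongr)

/-- The basic estimate of the integral by the variation. -/
theorem IsControl.norm_integral_le {v : ℝ → ℝ} {B : ℝ → F →L[ℝ] X} {y : ℝ → F} {a c d M : ℝ}
    {J : X} (hB : IsControl v B a) (hac : a ≤ c) (hcd : c ≤ d) (hy : ∀ r ∈ Icc c d, ‖y r‖ ≤ M)
    (hJ : HasKurzweilIntegral (fun τ t => B t (y τ)) c d J) : ‖J‖ ≤ (v d - v c) * M := by
  refine hJ.norm_le_of_locallyApprox hcd fun η hη => ⟨fun t => v t * M, by
    rw [← sub_mul]; linarith, fun τ hτ => ⟨1, one_pos, fun p q hp _ _ _ hpq _ _ => ?_⟩⟩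
  rw [sub_self, sub_zero, ← sub_mul]
  exact hB.norm_apply_sub_le (hac.trans hp) hpq.le (hy τ hτ)

/-- If `y` vanishes at the left endpoint, the jump of `B` there does not contribute to the
integral. -/
theorem IsControl.norm_integral_le_of_left_zero {v : ℝ → ℝ} {B : ℝ → F →L[ℝ] X} {y : ℝ → F}
    {a c d M : ℝ} {J : X} (hB : IsControl v B a) (hac : a ≤ c) (hcd : c < d)
    (hy : ∀ r ∈ Icc c d, ‖y r‖ ≤ M) (hc : y c = 0)
    (hJ : HasKurzweilIntegral (fun τ t => B t (y τ)) c d J) :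
    ‖J‖ ≤ (v d - Function.rightLim v c) * M := by
  have hM : 0 ≤ M := (norm_nonneg _).trans (hy c ⟨le_rfl, hcd.le⟩)
  refine hJ.norm_le_of_locallyApprox hcd.le fun η hη =>
    ⟨fun t => if c < t then (v t - Function.rightLim v c) * M else 0, by simp [hcd]; linarith,
      fun τ hτ => ?_⟩
  rcases hτ.1.lt_or_eq with h | rfl
  -- This gauge keeps `p > c`, so only the tag `c` can own the interval starting at `c`, where `y`
  -- vanishes. Hence `μ` may start from the right limit of `v`.
  · refine ⟨τ - c, by linarith, fun p q hp _ _ _ hpq h1 _ => ?_⟩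
    have hcp : c < p := by linarith
    simp only [hcp, hcp.trans hpq, if_true, sub_self, sub_zero]
    rw [← sub_mul, sub_sub_sub_cancel_right]
    exact hB.norm_apply_sub_le (hac.trans hp) hpq.le (hy τ hτ)
  · refine ⟨1, one_pos, fun p q hp hpc _ _ hpq _ _ => ?_⟩
    obtain rfl : p = c := le_antisymm hpc hp
    simp only [hc, map_zero, sub_self, norm_zero, hpq, if_true, lt_irrefl, if_false, sub_zero]
    exact mul_nonneg (sub_nonneg.2 (hB.mono.rightLim_le hpq)) hM

/-- The integral halves bounds with respect to the weight `exp (2 v)`. -/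
theorem IsControl.norm_integral_le_exp {v : ℝ → ℝ} {B : ℝ → F →L[ℝ] X} {y : ℝ → F} {a c d C : ℝ}
    {J : X} (hB : IsControl v B a) (hac : a ≤ c) (hcd : c ≤ d)
    (hy : ∀ r ∈ Icc c d, ‖y r‖ ≤ C * Real.exp (2 * v r))
    (hJ : HasKurzweilIntegral (fun τ t => B t (y τ)) c d J) :
    ‖J‖ ≤ C / 2 * (Real.exp (2 * v d) - Real.exp (2 * v c)) := by
  have hC : 0 ≤ C := nonneg_of_mul_nonneg_left
    ((norm_nonneg _).trans (hy c ⟨le_rfl, hcd⟩)) (Real.exp_pos _)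
  refine hJ.norm_le_of_locallyApprox hcd fun η hη => ?_
  have hv : 0 ≤ v d - v c := sub_nonneg.2 (hB.mono hcd)
  set κ := η / (v d - v c + 1) with hκ
  have hκ0 : 0 < κ := by positivity
  -- The term `κ * v t` absorbs the error of moving the weight from the tag back to the left
  -- endpoint `p`.
  refine ⟨fun t => C / 2 * Real.exp (2 * v t) + κ * v t, ?_, fun τ hτ => ?_⟩
  · have : κ * (v d - v c) ≤ η := by
      rw [hκ, div_mul_eq_mul_div, div_le_iff₀ (by positivity)]
      nlinarith
    linarith
  · have hl : ∀ t, ContinuousWithinAt (fun t => C * Real.exp (2 * v t)) (Iio t) t := fun t =>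
      ((Real.continuous_exp.continuousAt.comp_continuousWithinAt
        ((hB.leftCont t).const_mul 2))).const_mul C
    obtain ⟨δ, hδ, H⟩ := exists_left_small hl τ hκ0
    refine ⟨δ, hδ, fun p q hp hpτ _ _ hpq h1 _ => ?_⟩
    have hb : ‖y τ‖ ≤ C * Real.exp (2 * v p) + κ := by
      linarith [hy τ hτ, H p hpτ h1]
    have hvpq : 0 ≤ v q - v p := sub_nonneg.2 (hB.mono hpq.le)
    -- Convexity of `exp` at the left endpoint: this holds for increments of `v` of any size, which
    -- is why jumps of `B` need not be small.
    have hconv : (v q - v p) * Real.exp (2 * v p) ≤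
        (Real.exp (2 * v q) - Real.exp (2 * v p)) / 2 := by
      have e1 := Real.add_one_le_exp (2 * v q - 2 * v p)
      have e2 : Real.exp (2 * v q) = Real.exp (2 * v q - 2 * v p) * Real.exp (2 * v p) := by
        rw [← Real.exp_add]; ring_nf
      rw [e2]
      nlinarith [Real.exp_pos (2 * v p)]
    rw [sub_self, sub_zero]
    refine (hB.norm_apply_sub_le (hac.trans hp) hpq.le hb).trans ?_
    nlinarith

/-- The indefinite integral of a controlled function. -/
theorem IsControl.hasKurzweilIntegral_sub [CompleteSpace X] {v w : ℝ → ℝ} {B : ℝ → F →L[ℝ] X}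
    {y : ℝ → F} {s : ℝ} (hB : IsControl v B s) (hy : IsControl w y s) {c d : ℝ} (hsc : s ≤ c)
    (hcd : c ≤ d) :
    HasKurzweilIntegral (fun τ t => B t (y τ)) c d
      (kurzweilIntegral (fun τ t => B t (y τ)) s d -
        kurzweilIntegral (fun τ t => B t (y τ)) s c) := by
  obtain ⟨I, hI⟩ := hB.kurzweilIntegrable hy (hsc.trans hcd)
  obtain ⟨J, K, hJ, hK, hJK⟩ := hI.exists_split hsc hcd
  rw [hI.integral_eq (hsc.trans hcd), hJ.integral_eq hsc, ← hJK, add_sub_cancel_left]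
  exact hK

theorem kurzweilIntegral_self {X : Type*} [NormedAddCommGroup X] (G : ℝ → ℝ → X) (s : ℝ) :
    kurzweilIntegral G s s = 0 :=
  (hasKurzweilIntegral_self G s).integral_eq le_rfl

variable {B : ℝ → F →L[ℝ] F} {v : ℝ → ℝ} {a : ℝ}

theorem IsSolutionOn.mono {J J' : Set ℝ} {x : ℝ → F} (hx : IsSolutionOn B J x) (h : J' ⊆ J) :
    IsSolutionOn B J' x := fun c d hcd hJ => hx c d hcd (hJ.trans h)

theorem IsSolutionOn.sub {J : Set ℝ} {x y : ℝ → F} (hx : IsSolutionOn B J x)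
    (hy : IsSolutionOn B J y) : IsSolutionOn B J (fun t => x t - y t) := fun c d hcd hJ => by
  have := ((hx c d hcd hJ).sub (hy c d hcd hJ))
  rw [sub_sub_sub_comm] at this
  exact this.congr fun _ _ _ _ => (map_sub _ _ _).symm

theorem IsSolutionOn.congr {J : Set ℝ} {x y : ℝ → F} (hx : IsSolutionOn B J x)
    (h : EqOn x y J) : IsSolutionOn B J y := fun c d hcd hJ => by
  rw [← h (hJ ⟨hcd, le_rfl⟩), ← h (hJ ⟨le_rfl, hcd⟩)]
  exact (hx c d hcd hJ).congr fun τ hτ t _ => by rw [h (hJ hτ)]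

/-- Solutions are bounded on compact intervals. -/
theorem IsSolutionOn.exists_bound {x : ℝ → F} {c d : ℝ} (hB : IsControl v B a) (hac : a ≤ c)
    (hcd : c ≤ d) (hx : IsSolutionOn B (Icc c d) x) : ∃ M, ∀ r ∈ Icc c d, ‖x r‖ ≤ M := by
  refine interval_chain hcd (R := fun p q => ∃ M, ∀ r ∈ Icc p q, ‖x r‖ ≤ M) ?_ ?_ ?_
  · refine fun p _ => ⟨‖x p‖, fun r hr => ?_⟩
    rw [le_antisymm hr.2 hr.1]
  · rintro p m q - - - - ⟨M, hM⟩ ⟨N, hN⟩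
    refine ⟨max M N, fun r hr => ?_⟩
    rcases le_total r m with h | h
    · exact (hM r ⟨hr.1, h⟩).trans (le_max_left _ _)
    · exact (hN r ⟨h, hr.2⟩).trans (le_max_right _ _)
  · intro τ hτ
    -- No regularity of `x` is assumed. Near `τ`, up to an error `1`, the increment of `x` is that
    -- of `B` applied to the fixed vector `x τ`.
    obtain ⟨δ, hδ, H⟩ := saksHenstock_single (a := c) (b := d) (F := x)
      (fun p q hp hpq hq => hx p q hpq (Icc_subset_Icc hp hq)) one_pos hτ
    have hnn : 0 ≤ 1 + (v d - v c) * ‖x τ‖ := by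
      have := sub_nonneg.2 (hB.mono hcd); positivity
    refine ⟨δ, hδ, fun p hcp hp hpτ => ⟨‖x τ‖ + (1 + (v d - v c) * ‖x τ‖), fun r hr => ?_⟩,
      fun q hqd hτq hq => ⟨‖x τ‖ + (1 + (v d - v c) * ‖x τ‖), fun r hr => ?_⟩⟩
    · rcases hr.2.lt_or_eq with h | rfl
      · have h1 := H r τ (hcp.trans hr.1) h.le le_rfl hτ.2 h (by linarith [hr.1]) (by linarith)
        have h2 := hB.norm_apply_sub_le (hac.trans (hcp.trans hr.1)) h.le (le_refl ‖x τ‖)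
        have h3 : (v τ - v r) * ‖x τ‖ ≤ (v d - v c) * ‖x τ‖ := by
          have := hB.mono hτ.2
          have := hB.mono (hcp.trans hr.1)
          gcongr
        have h4 : x r = x τ + ((B τ (x τ) - B r (x τ) - (x τ - x r)) - (B τ (x τ) - B r (x τ))) := by
          abel
        have h5 := norm_sub_le (B τ (x τ) - B r (x τ) - (x τ - x r)) (B τ (x τ) - B r (x τ))
        rw [h4]
        refine (norm_add_le _ _).trans ?_
        linarith
      · linarith
    · rcases hr.1.lt_or_eq with h | rfl
      · have h1 := H τ r hτ.1 le_rfl h.le (hr.2.trans hqd) h (by linarith) (by linarith [hr.2])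
        have h2 := hB.norm_apply_sub_le (hac.trans hτ.1) h.le (le_refl ‖x τ‖)
        have h3 : (v r - v τ) * ‖x τ‖ ≤ (v d - v c) * ‖x τ‖ := by
          have := hB.mono (hr.2.trans hqd)
          have := hB.mono hτ.1
          gcongr
        have h4 : x r = x τ + ((B r (x τ) - B τ (x τ)) - (B r (x τ) - B τ (x τ) - (x r - x τ))) := by
          abel
        have h5 := norm_sub_le (B r (x τ) - B τ (x τ)) (B r (x τ) - B τ (x τ) - (x r - x τ))
        rw [h4]
        refine (norm_add_le _ _).trans ?_
        linarith
      · linarith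

/-- A bounded solution starting at `0` is its own integral, so its weighted bound can be halved
indefinitely. -/
theorem IsSolutionOn.eq_zero {x : ℝ → F} {c d : ℝ} (hB : IsControl v B a) (hac : a ≤ c)
    (hx : IsSolutionOn B (Icc c d) x) (h0 : x c = 0) : ∀ r ∈ Icc c d, x r = 0 := by
  intro r hr
  obtain ⟨M, hM⟩ := hx.exists_bound hB hac (hr.1.trans hr.2)
  have key : ∀ n : ℕ, ∀ t ∈ Icc c d,
      ‖x t‖ ≤ M / Real.exp (2 * v c) * (1 / 2) ^ n * Real.exp (2 * v t) := by
    intro n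
    induction n with
    | zero =>
      intro t ht
      have hM0 := (norm_nonneg _).trans (hM t ht)
      have := Real.exp_le_exp.2 (mul_le_mul_of_nonneg_left (hB.mono ht.1) zero_le_two)
      rw [pow_zero, mul_one, div_mul_eq_mul_div, le_div_iff₀ (Real.exp_pos _)]
      exact mul_le_mul (hM t ht) this (Real.exp_pos _).le hM0
    | succ n ih =>
      intro t ht
      have hJ := hx c t ht.1 (Icc_subset_Icc le_rfl ht.2)
      rw [h0, sub_zero] at hJ
      have h1 := hB.norm_integral_le_exp hac ht.1 (fun r hr => ih r ⟨hr.1, hr.2.trans ht.2⟩) hJ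
      have hM0 := (norm_nonneg _).trans (hM t ht)
      have : 0 ≤ M / Real.exp (2 * v c) * (1 / 2) ^ n / 2 * Real.exp (2 * v c) := by positivity
      rw [pow_succ]
      linarith
  have hlim : Tendsto (fun n : ℕ => M / Real.exp (2 * v c) * (1 / 2) ^ n * Real.exp (2 * v r))
      atTop (𝓝 (M / Real.exp (2 * v c) * 0 * Real.exp (2 * v r))) :=
    ((tendsto_pow_atTop_nhds_zero_of_lt_one (by norm_num) (by norm_num)).const_mul _).mul_const _
  rw [mul_zero, zero_mul] at hlim
  exact norm_le_zero_iff.1 (ge_of_tendsto' hlim fun n => key n r hr)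

/-- Uniqueness of solutions to the right of the initial point. -/
theorem IsSolutionOn.eqOn {x y : ℝ → F} {c d : ℝ} (hB : IsControl v B a) (hac : a ≤ c)
    (hx : IsSolutionOn B (Icc c d) x) (hy : IsSolutionOn B (Icc c d) y) (h0 : x c = y c) :
    EqOn x y (Icc c d) := fun r hr =>
  sub_eq_zero.1 ((hx.sub hy).eq_zero hB hac (sub_eq_zero.2 h0) r hr)

/-- Existence of solutions to the right of the initial point. -/
theorem IsControl.exists_solution [CompleteSpace F] (hB : IsControl v B a) {s : ℝ} (has : a ≤ s)
    (x₀ : F) : ∃ x : ℝ → F, x s = x₀ ∧ IsSolutionOn B (Ici s) x ∧ ∃ w, IsControl w x s := by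
  have hBs := hB.mono_left has
  set W : ℝ → ℝ := fun t => Real.exp (2 * v t) with hW
  have hWpos : ∀ t, 0 < W t := fun t => Real.exp_pos _
  have hWmono : Monotone W := fun p q hpq =>
    Real.exp_le_exp.2 (mul_le_mul_of_nonneg_left (hB.mono hpq) zero_le_two)
  have hWl : ∀ t, ContinuousWithinAt W (Iio t) t := fun t =>
    Real.continuous_exp.continuousAt.comp_continuousWithinAt ((hB.leftCont t).const_mul 2)
  set C : ℝ := ‖x₀‖ / W s with hC
  have hC0 : 0 ≤ C := by positivity
  have hx₀ : ‖x₀‖ = C * W s := by rw [hC, div_mul_cancel₀ _ (hWpos s).ne']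
  obtain ⟨x, hx0, hxs⟩ : ∃ x : ℕ → ℝ → F, (∀ t, x 0 t = x₀) ∧
      ∀ n t, x (n + 1) t = x₀ + kurzweilIntegral (fun τ t => B t (x n τ)) s t :=
    ⟨fun n => n.rec (fun _ => x₀) fun _ y t => x₀ + kurzweilIntegral (fun τ t => B t (y τ)) s t,
      fun _ => rfl, fun _ _ => rfl⟩
  -- The invariant reproduces itself: a bound `2 * C * W` is halved by integration, so the next
  -- iterate has increments controlled by `C * W`, and its value at `s` has norm `C * W s`. The
  -- control is common to all iterates and so survives the limit.
  have hxn : ∀ n, IsControl (fun t => C * W t) (x n) s ∧ ∀ r ≥ s, ‖x n r‖ ≤ 2 * C * W r := by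
    intro n
    induction n with
    | zero =>
      refine ⟨⟨hWmono.const_mul hC0, fun t => (hWl t).const_mul C, fun c d _ hcd => ?_⟩,
        fun r hr => ?_⟩
      · rw [hx0, hx0, sub_self, norm_zero]
        exact sub_nonneg.2 (mul_le_mul_of_nonneg_left (hWmono hcd) hC0)
      · rw [hx0, hx₀]
        nlinarith [mul_le_mul_of_nonneg_left (hWmono hr) hC0, mul_nonneg hC0 (hWpos r).le]
    | succ n ih =>
      have hinc : ∀ c d, s ≤ c → c ≤ d → ‖x (n + 1) d - x (n + 1) c‖ ≤ C * W d - C * W c := by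
        intro c d hsc hcd
        have h1 := hBs.norm_integral_le_exp hsc hcd
          (fun r hr => ih.2 r (hsc.trans hr.1)) (hBs.hasKurzweilIntegral_sub ih.1 hsc hcd)
        rw [hxs, hxs, add_sub_add_left_eq_sub]
        linarith
      refine ⟨⟨hWmono.const_mul hC0, fun t => (hWl t).const_mul C, hinc⟩, fun r hr => ?_⟩
      have h1 := hinc s r le_rfl hr
      have h2 : x (n + 1) s = x₀ := by rw [hxs, kurzweilIntegral_self, add_zero]
      rw [h2] at h1
      have h3 := norm_le_norm_sub_add (x (n + 1) r) x₀
      nlinarith [mul_nonneg hC0 (hWpos r).le]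
  have hint : ∀ n c d, s ≤ c → c ≤ d → HasKurzweilIntegral (fun τ t => B t (x n τ)) c d
      (x (n + 1) d - x (n + 1) c) := by
    intro n c d hsc hcd
    rw [hxs, hxs, add_sub_add_left_eq_sub]
    exact hBs.hasKurzweilIntegral_sub (hxn n).1 hsc hcd
  have hxns : ∀ n, x n s = x₀ := by
    rintro (_ | n)
    · exact hx0 s
    · rw [hxs, kurzweilIntegral_self, add_zero]
  have hdiff : ∀ n, ∀ r ≥ s, ‖x (n + 1) r - x n r‖ ≤ C * (1 / 2) ^ n * W r := by
    intro n
    induction n with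
    | zero =>
      intro r hr
      have h1 := (hxn (0 + 1)).1.norm_le s r le_rfl hr
      rw [hxns] at h1
      rw [hx0, pow_zero, mul_one]
      nlinarith [mul_nonneg hC0 (hWpos s).le]
    | succ n ih =>
      intro r hr
      have h1 := ((hint (n + 1) s r le_rfl hr).sub (hint n s r le_rfl hr)).congr
        (H := fun τ t => B t (x (n + 1) τ - x n τ)) fun τ _ t _ => (map_sub _ _ _).symm
      rw [hxns, hxns, sub_sub_sub_cancel_right] at h1
      have h2 := hBs.norm_integral_le_exp le_rfl hr (fun t ht => ih t ht.1) h1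
      have : 0 ≤ C * (1 / 2) ^ n / 2 * Real.exp (2 * v s) := by positivity
      rw [pow_succ]
      simp only [hW]
      linarith
  have hdist : ∀ r ≥ s, ∀ n, dist (x n r) (x (n + 1) r) ≤ C * W r * (1 / 2) ^ n := by
    intro r hr n
    rw [dist_comm, dist_eq_norm, mul_right_comm]
    exact hdiff n r hr
  have hlim : ∀ r, ∃ l, s ≤ r → Tendsto (fun n => x n r) atTop (𝓝 l) := by
    intro r
    by_cases hr : s ≤ r
    · obtain ⟨l, hl⟩ := cauchySeq_tendsto_of_complete
        (cauchySeq_of_le_geometric _ _ (by norm_num) (hdist r hr))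
      exact ⟨l, fun _ => hl⟩
    · exact ⟨0, fun h => absurd h hr⟩
  choose y hy using hlim
  have happrox : ∀ r ≥ s, ∀ n, ‖x n r - y r‖ ≤ 2 * (C * W r * (1 / 2) ^ n) := by
    intro r hr n
    have := dist_le_of_le_geometric_of_tendsto _ _ (by norm_num) (hdist r hr) (hy r hr) n
    rw [dist_eq_norm, show (1 : ℝ) - 1 / 2 = 2⁻¹ by norm_num, div_inv_eq_mul] at this
    linarith
  refine ⟨y, tendsto_nhds_unique (hy s le_rfl) (by simp only [hxns]; exact tendsto_const_nhds),
    fun c d hcd hJ => ?_, fun t => C * W t,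
    ⟨hWmono.const_mul hC0, fun t => (hWl t).const_mul C, fun c d hc hcd => ?_⟩⟩
  · have hsc : s ≤ c := hJ ⟨le_rfl, hcd⟩
    have hvcd : 0 ≤ v d - v c := sub_nonneg.2 (hB.mono hcd)
    refine hasKurzweilIntegral_of_approx fun ε hε => ?_
    have l1 : Tendsto (fun n => ‖x (n + 1) d - x (n + 1) c - (y d - y c)‖) atTop (𝓝 0) := by
      have h1 := (((hy d (hsc.trans hcd)).comp (tendsto_add_atTop_nat 1)).sub
        ((hy c hsc).comp (tendsto_add_atTop_nat 1))).sub_const (y d - y c)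
      rw [sub_self] at h1
      simpa using h1.norm
    have l2 : Tendsto (fun n : ℕ => (v d - v c) * (2 * (C * W d * (1 / 2) ^ n))) atTop (𝓝 0) := by
      have := (tendsto_pow_atTop_nhds_zero_of_lt_one (r := (1 / 2 : ℝ)) (by norm_num)
        (by norm_num)).const_mul (C * W d) |>.const_mul 2 |>.const_mul (v d - v c)
      simpa using this
    obtain ⟨n, hn1, hn2⟩ := ((l1.eventually (gt_mem_nhds hε)).and
      (l2.eventually (gt_mem_nhds hε))).exists
    refine ⟨_, _, hint n c d hsc hcd, hn1.le, fun P => ?_⟩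
    rw [← P.sum_sub]
    have := P.norm_sum_sub_le (G := fun τ t => B t (y τ) - B t (x n τ)) (F := fun _ => 0)
      (μ := fun t => v t * (2 * (C * W d * (1 / 2) ^ n))) (fun j hj => ?_)
    · simp only [sub_zero] at this
      rw [← sub_mul] at this
      exact this.trans hn2.le
    · have hp := P.left_le_pt hj.le
      have ht := P.tag_mem_Icc hj
      rw [sub_self, sub_zero, ← map_sub, ← map_sub, ← sub_mul]
      refine hBs.norm_apply_sub_le (hsc.trans hp) (P.pt_lt j hj).le ?_
      rw [norm_sub_rev]
      refine (happrox _ (hsc.trans ht.1) n).trans ?_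
      have := hWmono ht.2
      gcongr
  · exact le_of_tendsto ((hy d (hc.trans hcd)).sub (hy c hc)).norm
      (Eventually.of_forall fun n => (hxn n).1.norm_le c d hc hcd)

end LinearEquation

/-- Applying the self-improving bound to the supremum `S` gives `S ≤ V + κ * S`. The a priori bound
`M₀` only ensures that `S` is finite. -/
theorem norm_le_div_of_self_bound {F : Type*} [NormedAddCommGroup F] {z : ℝ → F} {c d V κ M₀ : ℝ}
    (h₀ : ∀ r ∈ Icc c d, ‖z r‖ ≤ M₀) (hκ : κ < 1)
    (h : ∀ M, (∀ r ∈ Icc c d, ‖z r‖ ≤ M) → ∀ r ∈ Icc c d, ‖z r‖ ≤ V + κ * M) :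
    ∀ r ∈ Icc c d, ‖z r‖ ≤ V / (1 - κ) := by
  intro r hr
  have hbdd : BddAbove ((fun r => ‖z r‖) '' Icc c d) := ⟨M₀, by rintro _ ⟨r, hr, rfl⟩; exact h₀ r hr⟩
  have hle : ∀ r ∈ Icc c d, ‖z r‖ ≤ sSup ((fun r => ‖z r‖) '' Icc c d) := fun r hr =>
    le_csSup hbdd ⟨r, hr, rfl⟩
  have hS : sSup ((fun r => ‖z r‖) '' Icc c d) ≤
      V + κ * sSup ((fun r => ‖z r‖) '' Icc c d) :=
    csSup_le ⟨_, r, hr, rfl⟩ (by rintro _ ⟨r, hr, rfl⟩; exact h _ hle r hr)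
  refine (hle r hr).trans ?_
  rw [le_div_iff₀ (by linarith)]
  linarith

/-! ### The fundamental matrix, its invertibility and the two-sided transition matrix. -/

section Transition

variable {E : Type*} [NormedAddCommGroup E] [NormedSpace ℝ E]

theorem kurzweilIntegral_symm {X : Type*} [NormedAddCommGroup X] (G : ℝ → ℝ → X) {s t : ℝ}
    (h : t < s) : kurzweilIntegral G s t = -kurzweilIntegral G t s := by
  rw [kurzweilIntegral, kurzweilIntegral, if_neg (not_le.2 h), if_pos h.le]
  split_ifs <;> simp

/-- The operator of left multiplication by `A t`. -/
noncomputable def leftMul (A : ℝ → E →L[ℝ] E) (t : ℝ) : (E →L[ℝ] E) →L[ℝ] (E →L[ℝ] E) :=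
  ContinuousLinearMap.mul ℝ (E →L[ℝ] E) (A t)

theorem leftMul_apply (A : ℝ → E →L[ℝ] E) (t : ℝ) (X : E →L[ℝ] E) : leftMul A t X = A t * X := rfl

/-- The matrix equation is the vector equation in the space of operators, with coefficient `leftMul
A`; the same control serves, so the existence and uniqueness results apply to it. -/
theorem IsControl.leftMul {v : ℝ → ℝ} {A : ℝ → E →L[ℝ] E} {a : ℝ} (hA : IsControl v A a) :
    IsControl v (leftMul A) a := by
  refine ⟨hA.mono, hA.leftCont, fun c d hc hcd => ?_⟩
  rw [GLDE.leftMul, GLDE.leftMul, ← map_sub]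
  exact (ContinuousLinearMap.opNorm_mul_apply_le ℝ _ _).trans (hA.norm_le c d hc hcd)

theorem IsSolutionOn.mul_const {A : ℝ → E →L[ℝ] E} {J : Set ℝ} {X : ℝ → E →L[ℝ] E}
    (hX : IsSolutionOn (leftMul A) J X) (C : E →L[ℝ] E) :
    IsSolutionOn (leftMul A) J (fun t => X t * C) := fun c d hcd hJ => by
  have := (hX c d hcd hJ).map ((ContinuousLinearMap.mul ℝ (E →L[ℝ] E)).flip C)
  simpa only [ContinuousLinearMap.flip_apply, ContinuousLinearMap.mul_apply', leftMul_apply,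
    sub_mul, mul_assoc] using this

theorem IsSolutionOn.apply_const {A : ℝ → E →L[ℝ] E} {J : Set ℝ} {X : ℝ → E →L[ℝ] E}
    (hX : IsSolutionOn (leftMul A) J X) (e : E) : IsSolutionOn A J (fun t => X t e) :=
  fun c d hcd hJ => (hX c d hcd hJ).map (ContinuousLinearMap.apply ℝ E e)

/-- `Φ t s`, for `t ≥ s ≥ 0`, is the fundamental matrix with `Φ s s = 1`. -/
structure IsForwardMatrix (A : ℝ → E →L[ℝ] E) (Φ : ℝ → ℝ → E →L[ℝ] E) : Prop where
  diag : ∀ s ≥ 0, Φ s s = 1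
  sol : ∀ s ≥ 0, IsSolutionOn (leftMul A) (Ici s) (fun t => Φ t s)
  control : ∀ s ≥ 0, ∃ w, IsControl w (fun t => Φ t s) s

variable {A : ℝ → E →L[ℝ] E} {v : ℝ → ℝ} {Φ : ℝ → ℝ → E →L[ℝ] E}

theorem IsControl.exists_isForwardMatrix [CompleteSpace E] (hA : IsControl v A 0) :
    ∃ Φ, IsForwardMatrix A Φ := by
  have h : ∀ s : ℝ, ∃ x : ℝ → E →L[ℝ] E, 0 ≤ s →
      x s = 1 ∧ IsSolutionOn (GLDE.leftMul A) (Ici s) x ∧ ∃ w, IsControl w x s := by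
    intro s
    by_cases hs : 0 ≤ s
    · obtain ⟨x, hx⟩ := hA.leftMul.exists_solution hs 1
      exact ⟨x, fun _ => hx⟩
    · exact ⟨0, fun h => absurd h hs⟩
  choose x hx using h
  exact ⟨fun t s => x s t, fun s hs => (hx s hs).1, fun s hs => (hx s hs).2.1,
    fun s hs => (hx s hs).2.2⟩

theorem IsForwardMatrix.eq_mul (hΦ : IsForwardMatrix A Φ) (hA : IsControl v A 0) {s t : ℝ}
    (hs : 0 ≤ s) (hst : s ≤ t) {X : ℝ → E →L[ℝ] E} (hX : IsSolutionOn (leftMul A) (Icc s t) X) :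
    X t = Φ t s * X s := by
  refine hX.eqOn hA.leftMul hs (((hΦ.sol s hs).mul_const (X s)).mono Icc_subset_Ici_self) ?_
    ⟨hst, le_rfl⟩
  rw [hΦ.diag s hs, one_mul]

theorem IsForwardMatrix.eq_apply (hΦ : IsForwardMatrix A Φ) (hA : IsControl v A 0) {s t : ℝ}
    (hs : 0 ≤ s) (hst : s ≤ t) {x : ℝ → E} (hx : IsSolutionOn A (Icc s t) x) :
    x t = Φ t s (x s) := by
  refine hx.eqOn hA hs (((hΦ.sol s hs).apply_const (x s)).mono Icc_subset_Ici_self) ?_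
    ⟨hst, le_rfl⟩
  rw [hΦ.diag s hs, one_apply_eq_self]

theorem IsForwardMatrix.mul (hΦ : IsForwardMatrix A Φ) (hA : IsControl v A 0) {s r t : ℝ}
    (hs : 0 ≤ s) (hsr : s ≤ r) (hrt : r ≤ t) : Φ t s = Φ t r * Φ r s :=
  hΦ.eq_mul hA (hs.trans hsr) hrt
    ((hΦ.sol s hs).mono (Icc_subset_Ici_self.trans (Ici_subset_Ici.2 hsr)))

theorem IsForwardMatrix.hasKurzweilIntegral (hΦ : IsForwardMatrix A Φ) {s t : ℝ}
    (hs : 0 ≤ s) (hst : s ≤ t) :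
    HasKurzweilIntegral (fun τ r => A r * Φ τ s) s t (Φ t s - 1) := by
  have := hΦ.sol s hs s t hst Icc_subset_Ici_self
  beta_reduce at this
  rwa [hΦ.diag s hs] at this

/-- The difference `Φ t s - 1 - (A t - A s)` is the integral of `Φ r s - 1`, which vanishes at `r =
s`. The jump of `A` at `s` therefore drops out and the remainder tends to `0`. -/
theorem IsForwardMatrix.tendsto_right [CompleteSpace E] (hΦ : IsForwardMatrix A Φ)
    (hA : IsControl v A 0) {s : ℝ} (hs : 0 ≤ s) :
    Tendsto (fun t => Φ t s) (𝓝[>] s) (𝓝 (1 + (Function.rightLim A s - A s))) := by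
  obtain ⟨L, hL, -⟩ := hA.exists_right_limit hs
  rw [rightLim_eq_of_tendsto hL]
  obtain ⟨w, hw⟩ := hΦ.control s hs
  set M := w (s + 1) - w s
  have hM : ∀ r ∈ Icc s (s + 1), ‖Φ r s - 1‖ ≤ M := by
    intro r hr
    have := hw.norm_le s r le_rfl hr.1
    rw [hΦ.diag s hs] at this
    linarith [hw.mono hr.2]
  have hb : ∀ t ∈ Ioc s (s + 1),
      ‖Φ t s - 1 - (A t - A s)‖ ≤ (v t - Function.rightLim v s) * M := by
    intro t ht
    refine hA.leftMul.norm_integral_le_of_left_zero hs ht.1 (y := fun r => Φ r s - 1)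
      (fun r hr => hM r ⟨hr.1, hr.2.trans ht.2⟩) (by rw [hΦ.diag s hs, sub_self]) ?_
    refine ((hΦ.hasKurzweilIntegral hs ht.1.le).sub (hasKurzweilIntegral_const A s t)).congr ?_
    intro τ _ r _
    rw [leftMul_apply, mul_sub, mul_one]
  have h0 : Tendsto (fun t => Φ t s - 1 - (A t - A s)) (𝓝[>] s) (𝓝 0) := by
    refine squeeze_zero_norm' (a := fun t => (v t - Function.rightLim v s) * M) ?_ ?_
    · filter_upwards [Ioc_mem_nhdsGT (lt_add_one s)] with t ht using hb t ht
    · have := ((hA.mono.tendsto_rightLim s).sub_const (Function.rightLim v s)).mul_const M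
      simpa using this
  have h1 := (h0.add (hL.sub_const (A s))).const_add 1
  rw [zero_add] at h1
  refine h1.congr fun t => by abel

theorem IsForwardMatrix.isUnit [CompleteSpace E] (hΦ : IsForwardMatrix A Φ)
    (hA : IsControl v A 0) (hD : ∀ t ≥ 0, IsUnit (1 + (Function.rightLim A t - A t))) {s t : ℝ}
    (hs : 0 ≤ s) (hst : s ≤ t) : IsUnit (Φ t s) := by
  refine interval_chain hst (R := fun c d => IsUnit (Φ d c)) ?_ ?_ ?_
  · intro c hc
    rw [hΦ.diag c (hs.trans hc.1)]
    exact isUnit_one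
  · intro c m d hc hcm hmd _ h1 h2
    rw [hΦ.mul hA (hs.trans hc) hcm hmd]
    exact h2.mul h1
  · intro τ hτ
    have hτ0 : 0 ≤ τ := hs.trans hτ.1
    have hr : ∀ᶠ d in 𝓝[>] τ, IsUnit (Φ d τ) :=
      (hΦ.tendsto_right hA hτ0).eventually (Units.isOpen.mem_nhds (hD τ hτ0))
    obtain ⟨u, hu, hsub⟩ := mem_nhdsGT_iff_exists_Ioo_subset.1 hr
    -- With variation below `1 / 3`, the self-bound gives `‖Φ‖ ≤ 3 / 2`, hence `‖Φ - 1‖ ≤ 1 / 2` and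
    -- a Neumann series applies.
    obtain ⟨δ, hδ, H⟩ := exists_left_small hA.leftCont τ (show (0 : ℝ) < 1 / 3 by norm_num)
    refine ⟨min δ (u - τ), lt_min hδ (sub_pos.2 hu), fun c hc h1 hcτ => ?_, fun d _ h1 h2 => ?_⟩
    · have hc0 : 0 ≤ c := hs.trans hc
      have hv := H c hcτ.le (by linarith [min_le_left δ (u - τ)])
      have hest : ∀ M, (∀ r ∈ Icc c τ, ‖Φ r c‖ ≤ M) → ∀ r ∈ Icc c τ, ‖Φ r c - 1‖ ≤ 1 / 3 * M := by
        intro M hM r hr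
        have hM0 : 0 ≤ M := (norm_nonneg _).trans (hM r hr)
        have h3 := hA.leftMul.norm_integral_le hc0 hr.1
          (fun q hq => hM q ⟨hq.1, hq.2.trans hr.2⟩) (hΦ.hasKurzweilIntegral hc0 hr.1)
        have h4 := hA.mono hr.2
        refine h3.trans ?_
        gcongr
        linarith
      obtain ⟨M₀, hM₀⟩ := ((hΦ.sol c hc0).mono Icc_subset_Ici_self).exists_bound hA.leftMul hc0
        hcτ.le
      have hone : ‖(1 : E →L[ℝ] E)‖ ≤ 1 := ContinuousLinearMap.norm_id_le
      have hb := norm_le_div_of_self_bound (V := 1) hM₀ (show (1 / 3 : ℝ) < 1 by norm_num)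
        (fun M hM r hr => by
          have := norm_le_norm_sub_add (Φ r c) 1
          linarith [hest M hM r hr])
      have hlt : ‖1 - Φ τ c‖ < 1 := by
        rw [norm_sub_rev]
        have := hest _ hb τ ⟨hcτ.le, le_rfl⟩
        norm_num at this
        linarith
      simpa using isUnit_one_sub_of_norm_lt_one hlt
    · exact hsub ⟨h1, by linarith [min_le_right δ (u - τ)]⟩

open Classical in
/-- The transition matrix in both time directions. -/
noncomputable def twoSided (Φ : ℝ → ℝ → E →L[ℝ] E) (t s : ℝ) : E →L[ℝ] E :=
  if s ≤ t then Φ t s else Ring.inverse (Φ s t)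

theorem twoSided_of_le {s t : ℝ} (h : s ≤ t) : twoSided Φ t s = Φ t s := if_pos h

theorem IsForwardMatrix.twoSided_of_ge (hΦ : IsForwardMatrix A Φ) {s t : ℝ} (ht : 0 ≤ t)
    (h : t ≤ s) : twoSided Φ t s = Ring.inverse (Φ s t) := by
  rcases h.lt_or_eq with h | rfl
  · exact if_neg (not_le.2 h)
  · rw [twoSided_of_le le_rfl, hΦ.diag t ht, Ring.inverse_one]

theorem IsForwardMatrix.isTransitionMatrix [CompleteSpace E] (hΦ : IsForwardMatrix A Φ)
    (hA : IsControl v A 0) (hD : ∀ t ≥ 0, IsUnit (1 + (Function.rightLim A t - A t))) :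
    IsTransitionMatrix A (twoSided Φ) := by
  intro t ht s hs
  rcases le_or_gt s t with hst | hts
  · have h : HasKurzweilIntegral (fun τ r => A r * twoSided Φ τ s) s t (Φ t s - 1) :=
      (hΦ.hasKurzweilIntegral hs hst).congr fun τ hτ r _ => by rw [twoSided_of_le hτ.1]
    rw [min_eq_left hst, max_eq_right hst]
    refine ⟨⟨_, h⟩, ?_⟩
    rw [h.integral_eq hst, twoSided_of_le hst, add_sub_cancel]
  -- By the cocycle identity the inverses are, as functions of `τ`, a right multiple of the forward
  -- solution started at `t`; hence they solve the same equation.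
  · have hinv : ∀ τ ∈ Icc t s, twoSided Φ τ s = Φ τ t * Ring.inverse (Φ s t) := by
      intro τ hτ
      have hu := hΦ.isUnit hA hD (ht.trans hτ.1) hτ.2
      have hu' := hΦ.isUnit hA hD ht hts.le
      rw [hΦ.twoSided_of_ge (ht.trans hτ.1) hτ.2]
      calc Ring.inverse (Φ s τ) = Ring.inverse (Φ s τ) * (Φ s t * Ring.inverse (Φ s t)) := by
            rw [Ring.mul_inverse_cancel _ hu', mul_one]
        _ = Ring.inverse (Φ s τ) * Φ s τ * (Φ τ t * Ring.inverse (Φ s t)) := by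
            rw [hΦ.mul hA ht hτ.1 hτ.2]; simp only [mul_assoc]
        _ = Φ τ t * Ring.inverse (Φ s t) := by rw [Ring.inverse_mul_cancel _ hu, one_mul]
    have h := ((hΦ.sol t ht).mul_const (Ring.inverse (Φ s t))) t s hts.le Icc_subset_Ici_self
    beta_reduce at h
    rw [← hinv s ⟨hts.le, le_rfl⟩, ← hinv t ⟨le_rfl, hts.le⟩, twoSided_of_le le_rfl,
      hΦ.diag s hs] at h
    have h' : HasKurzweilIntegral (fun τ r => A r * twoSided Φ τ s) t s (1 - twoSided Φ t s) :=
      h.congr fun τ hτ r _ => by rw [leftMul_apply, hinv τ hτ]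
    rw [min_eq_right hts.le, max_eq_left hts.le]
    refine ⟨⟨_, h'⟩, ?_⟩
    rw [kurzweilIntegral_symm _ hts, h'.integral_eq hts.le]
    abel

theorem IsTransitionMatrix.diag {V : ℝ → ℝ → E →L[ℝ] E} (hV : IsTransitionMatrix A V) {s : ℝ}
    (hs : 0 ≤ s) : V s s = 1 := by
  rw [(hV s hs s hs).2, kurzweilIntegral_self, add_zero]

/-- Additivity of the integral makes `V · s` a solution on the interval between `s` and `t`, so
forward uniqueness expresses its value at the right end through `Φ`. If `t < s`, this reads `1 = Φ s
t * V t s` and `Φ s t` is invertible. -/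
theorem IsTransitionMatrix.eq_twoSided [CompleteSpace E] {V : ℝ → ℝ → E →L[ℝ] E}
    (hV : IsTransitionMatrix A V) (hΦ : IsForwardMatrix A Φ)
    (hA : IsControl v A 0) (hD : ∀ t ≥ 0, IsUnit (1 + (Function.rightLim A t - A t))) {t s : ℝ}
    (ht : 0 ≤ t) (hs : 0 ≤ s) : V t s = twoSided Φ t s := by
  rcases le_or_gt s t with hst | hts
  · have hint : ∀ c, s ≤ c → HasKurzweilIntegral (fun τ r => A r * V τ s) s c (V c s - 1) := by
      intro c hc
      obtain ⟨⟨I, hI⟩, h2⟩ := hV c (hs.trans hc) s hs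
      rw [min_eq_left hc, max_eq_right hc] at hI
      rw [hI.integral_eq hc] at h2
      rwa [h2, add_sub_cancel_left]
    have hsol : IsSolutionOn (leftMul A) (Icc s t) (fun r => V r s) := by
      intro c d hcd hJ
      have hsc : s ≤ c := (hJ ⟨le_rfl, hcd⟩).1
      obtain ⟨J, K, hJ, hK, hJK⟩ := (hint d (hsc.trans hcd)).exists_split hsc hcd
      have hJ' := hJ.unique hsc (hint c hsc)
      have hK' : K = V d s - V c s := by
        rw [hJ'] at hJK
        rw [eq_sub_of_add_eq' hJK]
        abel
      rw [← hK']
      exact hK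
    have := hΦ.eq_mul hA hs hst hsol
    rwa [hV.diag hs, mul_one, ← twoSided_of_le (Φ := Φ) hst] at this
  · have hint : ∀ c, 0 ≤ c → c ≤ s →
        HasKurzweilIntegral (fun τ r => A r * V τ s) c s (1 - V c s) := by
      intro c hc0 hc
      rcases hc.lt_or_eq with hlt | rfl
      · obtain ⟨⟨I, hI⟩, h2⟩ := hV c hc0 s hs
        rw [min_eq_right hc, max_eq_left hc] at hI
        rw [kurzweilIntegral_symm _ hlt, hI.integral_eq hc] at h2
        have : 1 - V c s = I := by rw [h2]; abel
        rwa [this]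
      · rw [hV.diag hs, sub_self]
        exact hasKurzweilIntegral_self _ _
    have hsol : IsSolutionOn (leftMul A) (Icc t s) (fun r => V r s) := by
      intro c d hcd hJ
      have htc : t ≤ c := (hJ ⟨le_rfl, hcd⟩).1
      have hds : d ≤ s := (hJ ⟨hcd, le_rfl⟩).2
      obtain ⟨J, K, hJ, hK, hJK⟩ :=
        (hint c (ht.trans htc) (hcd.trans hds)).exists_split hcd hds
      have hK' := hK.unique hds (hint d (ht.trans (htc.trans hcd)) hds)
      have hJ' : J = V d s - V c s := by
        rw [hK'] at hJK
        rw [eq_sub_of_add_eq hJK]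
        abel
      rw [← hJ']
      exact hJ
    have h1 := hΦ.eq_mul hA ht hts.le hsol
    have hu := hΦ.isUnit hA hD ht hts.le
    rw [hV.diag hs] at h1
    rw [hΦ.twoSided_of_ge ht hts.le]
    calc V t s = Ring.inverse (Φ s t) * Φ s t * V t s := by
          rw [Ring.inverse_mul_cancel _ hu, one_mul]
      _ = Ring.inverse (Φ s t) := by rw [mul_assoc, ← h1, mul_one]

end Transition

/-! ### Perturbation estimate and the equivalence of the stability notions. -/

section Stability

variable {E : Type*} [NormedAddCommGroup E] [NormedSpace ℝ E]

theorem IsControl.isAdmissible {X : Type*} [NormedAddCommGroup X] {w : ℝ → ℝ} {y : ℝ → X} {s : ℝ}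
    (h : IsControl w y s) : IsAdmissible s y := by
  constructor
  · intro p q hp hq
    have hw := (h.mono.monotoneOn (Ici s)).locallyBoundedVariationOn p q hp hq
    refine ne_top_of_le_ne_top hw ?_
    refine iSup_mono fun u => Finset.sum_le_sum fun i _ => ?_
    have hi := (u.2.2.2 i).1
    have hle := u.2.2.1 (Nat.le_succ i)
    rw [edist_dist, edist_dist, dist_eq_norm, dist_eq_norm]
    refine ENNReal.ofReal_le_ofReal ((h.norm_le _ _ hi hle).trans ?_)
    exact le_abs_self _
  · intro t ht
    rw [ContinuousWithinAt, tendsto_iff_norm_sub_tendsto_zero]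
    have h0 : Tendsto (fun p => w t - w p) (𝓝[<] t) (𝓝 0) := by
      simpa using (h.leftCont t).tendsto.const_sub (w t)
    refine squeeze_zero' (Eventually.of_forall fun _ => norm_nonneg _) ?_ h0
    filter_upwards [Ioo_mem_nhdsLT ht] with p hp
    rw [norm_sub_rev]
    exact h.norm_le p t hp.1.le hp.2.le

variable {A : ℝ → E →L[ℝ] E} {v : ℝ → ℝ} {Φ : ℝ → ℝ → E →L[ℝ] E}

/-- By uniqueness every solution is the one built by Picard iteration, which comes with a control.
-/
theorem IsSolutionOn.isAdmissible [CompleteSpace E] (hA : IsControl v A 0) {s : ℝ} (hs : 0 ≤ s)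
    {x : ℝ → E} (hx : IsSolutionOn A (Ici s) x) : IsAdmissible s x := by
  obtain ⟨y, hys, hy, w, hw⟩ := hA.exists_solution hs (x s)
  have heq : ∀ r ≥ s, y r = x r := fun r hr =>
    (hy.mono Icc_subset_Ici_self).eqOn hA hs (hx.mono Icc_subset_Ici_self) hys ⟨hr, le_rfl⟩
  refine IsControl.isAdmissible (w := w) ⟨hw.mono, hw.leftCont, fun c d hc hcd => ?_⟩
  rw [← heq c hc, ← heq d (hc.trans hcd)]
  exact hw.norm_le c d hc hcd

theorem IsSolutionOn.defectVariation_eq_zero {s : ℝ} {x : ℝ → E}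
    (hx : IsSolutionOn A (Ici s) x) : defectVariation A s x = 0 := by
  refine le_antisymm (iSup₂_le fun t _ => le_of_eq (eVariationOn.constant_on ?_)) zero_le
  have : ∀ r ∈ Icc s t, x r - kurzweilIntegral (fun τ r => A r (x τ)) s r = x s := by
    intro r hr
    rw [(hx s r hr.1 Icc_subset_Ici_self).integral_eq hr.1, sub_sub_cancel]
  rintro _ ⟨p, hp, rfl⟩ _ ⟨q, hq, rfl⟩
  exact (this p hp).trans (this q hq).symm

theorem le_of_forall_le_div_one_sub {a b : ℝ} (hb : 0 ≤ b)
    (h : ∀ κ, 0 < κ → κ < 1 → a ≤ b / (1 - κ)) : a ≤ b := by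
  by_contra hab
  have hab := not_le.1 hab
  have ha : 0 < a := hb.trans_lt hab
  have h1 : (a - b) / (2 * a) < 1 := by rw [div_lt_one (by positivity)]; linarith
  have h2 := h ((a - b) / (2 * a)) (div_pos (by linarith) (by positivity)) h1
  rw [le_div_iff₀ (by linarith)] at h2
  have h3 : a * (1 - (a - b) / (2 * a)) = (a + b) / 2 := by field_simp; ring
  linarith

/-- On an interval over which `A`, apart from its jump at the left endpoint, varies little, a
function differs from the solution with the same initial value by little more than the variation
of its defect. -/
theorem IsForwardMatrix.norm_sub_le_of_small [CompleteSpace E] (hΦ : IsForwardMatrix A Φ)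
    (hA : IsControl v A 0) {w ν : ℝ → ℝ} {y : ℝ → E} {s c d κ : ℝ} (hs : 0 ≤ s)
    (hy : IsControl w y s) (hsc : s ≤ c) (hcd : c < d) (hκ : κ < 1)
    (hν : ∀ p q, c ≤ p → p ≤ q → q ≤ d →
      ‖(y q - kurzweilIntegral (fun τ r => A r (y τ)) s q) -
        (y p - kurzweilIntegral (fun τ r => A r (y τ)) s p)‖ ≤ ν q - ν p)
    (hv : v d - Function.rightLim v c ≤ κ) : ‖y d - Φ d c (y c)‖ ≤ (ν d - ν c) / (1 - κ) := by
  have hc0 : 0 ≤ c := hs.trans hsc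
  have hsol := (hΦ.sol c hc0).apply_const (y c)
  have hcc : Φ c c (y c) = y c := by rw [hΦ.diag c hc0, one_apply_eq_self]
  obtain ⟨N, hN⟩ := (hsol.mono (Icc_subset_Ici_self : Icc c d ⊆ Ici c)).exists_bound hA hc0 hcd.le
  have hbd : ∀ r ∈ Icc c d, ‖y r - Φ r c (y c)‖ ≤ ‖y c‖ + (w d - w c) + N := by
    intro r hr
    have h1 := hy.norm_le c r hsc hr.1
    have h2 := hy.mono hr.2
    have h3 := norm_le_norm_sub_add (y r) (y c)
    have h4 := norm_sub_le (y r) (Φ r c (y c))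
    linarith [hN r hr]
  refine norm_le_div_of_self_bound (z := fun r => y r - Φ r c (y c)) hbd hκ ?_ d
    ⟨hcd.le, le_rfl⟩
  intro M hM r hr
  have hM0 : 0 ≤ M := (norm_nonneg _).trans (hM c ⟨le_rfl, hcd.le⟩)
  rcases hr.1.lt_or_eq with hcr | rfl
  -- Up to the defect, `y - Φ · c (y c)` is the integral of itself, and it vanishes at `c`. So the
  -- jump of `A` at `c`, which may be large, does not enter and the factor is `κ`.
  · have hint := (((hA.mono_left hs).hasKurzweilIntegral_sub hy hsc hr.1).sub
      (hsol c r hr.1 Icc_subset_Ici_self)).congr (H := fun τ t => A t (y τ - Φ τ c (y c)))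
      fun τ _ t _ => (map_sub _ _ _).symm
    have hJ := hA.norm_integral_le_of_left_zero hc0 hcr
      (fun q hq => hM q ⟨hq.1, hq.2.trans hr.2⟩) (by rw [hcc, sub_self]) hint
    have hg := hν c r le_rfl hr.1 hr.2
    have hν' := (norm_nonneg _).trans (hν r d hr.1 hr.2 le_rfl)
    have hκM : (v r - Function.rightLim v c) * M ≤ κ * M := by
      have := hA.mono hr.2
      gcongr
      linarith
    have hadd := norm_add_le
      ((y r - kurzweilIntegral (fun τ r => A r (y τ)) s r) -
        (y c - kurzweilIntegral (fun τ r => A r (y τ)) s c))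
      (kurzweilIntegral (fun τ r => A r (y τ)) s r - kurzweilIntegral (fun τ r => A r (y τ)) s c -
        (Φ r c (y c) - Φ c c (y c)))
    beta_reduce at hJ
    rw [hcc] at hadd hJ
    have e : y r - Φ r c (y c) = ((y r - kurzweilIntegral (fun τ r => A r (y τ)) s r) -
        (y c - kurzweilIntegral (fun τ r => A r (y τ)) s c)) +
      (kurzweilIntegral (fun τ r => A r (y τ)) s r - kurzweilIntegral (fun τ r => A r (y τ)) s c -
        (Φ r c (y c) - y c)) := by abel
    rw [e]
    linarith
  · have h1 := (norm_nonneg _).trans (hν c d le_rfl hcd.le le_rfl)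
    have h2 := hA.mono.rightLim_le hcd
    rw [hcc, sub_self, norm_zero]
    have : 0 ≤ κ := by linarith
    positivity

/-- The estimate that follows from the variation of constants formula. -/
theorem IsForwardMatrix.norm_sub_le [CompleteSpace E] (hΦ : IsForwardMatrix A Φ)
    (hA : IsControl v A 0) {w ν : ℝ → ℝ} {y : ℝ → E} {s t K : ℝ} (hs : 0 ≤ s) (hst : s ≤ t)
    (hy : IsControl w y s)
    (hν : ∀ p q, s ≤ p → p ≤ q → q ≤ t →
      ‖(y q - kurzweilIntegral (fun τ r => A r (y τ)) s q) -
        (y p - kurzweilIntegral (fun τ r => A r (y τ)) s p)‖ ≤ ν q - ν p)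
    (hK : ∀ r ∈ Icc s t, ‖Φ t r‖ ≤ K) : ‖y t - Φ t s (y s)‖ ≤ K * (ν t - ν s) := by
  have hK0 : 0 ≤ K := (norm_nonneg _).trans (hK s ⟨le_rfl, hst⟩)
  have hνst : 0 ≤ ν t - ν s := (norm_nonneg _).trans (hν s t le_rfl hst le_rfl)
  refine le_of_forall_le_div_one_sub (by positivity) fun κ hκ0 hκ1 => ?_
  have hone : 0 < 1 - κ := by linarith
  -- By the cocycle identity the increment of `r ↦ Φ t r (y r)` is `Φ t d` applied to the local
  -- error on `[c, d]`.
  have step : ∀ c d, s ≤ c → c < d → d ≤ t → v d - Function.rightLim v c ≤ κ →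
      ‖Φ t d (y d) - Φ t c (y c)‖ ≤ K * (ν d - ν c) / (1 - κ) := by
    intro c d hsc hcd hdt hv
    have h1 := hΦ.norm_sub_le_of_small hA hs hy hsc hcd hκ1
      (fun p q hp hpq hq => hν p q (hsc.trans hp) hpq (hq.trans hdt)) hv
    have h2 : Φ t d (y d) - Φ t c (y c) = Φ t d (y d - Φ d c (y c)) := by
      rw [map_sub, hΦ.mul hA (hs.trans hsc) hcd.le hdt]
      rfl
    rw [h2, mul_div_assoc]
    refine ((Φ t d).le_opNorm _).trans ?_
    have := hK d ⟨hsc.trans hcd.le, hdt⟩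
    gcongr
  have key := interval_chain hst
    (R := fun c d => ‖Φ t d (y d) - Φ t c (y c)‖ ≤ K * (ν d - ν c) / (1 - κ)) ?_ ?_ ?_
  · rwa [hΦ.diag t (hs.trans hst), one_apply_eq_self] at key
  · intro c _
    simp
  · intro c m d _ _ _ _ h1 h2
    have h3 := norm_add_le (Φ t d (y d) - Φ t m (y m)) (Φ t m (y m) - Φ t c (y c))
    rw [sub_add_sub_cancel] at h3
    have h4 : K * (ν d - ν c) / (1 - κ) =
        K * (ν d - ν m) / (1 - κ) + K * (ν m - ν c) / (1 - κ) := by ring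
    linarith
  · intro τ hτ
    -- Every point has such short intervals on both sides: `v` is left-continuous, and to the right
    -- its jump at `τ` is not counted.
    obtain ⟨δ₁, hδ₁, H₁⟩ := exists_left_small hA.leftCont τ hκ0
    obtain ⟨δ₂, hδ₂, H₂⟩ := exists_right_small hA.mono τ hκ0
    refine ⟨min δ₁ δ₂, lt_min hδ₁ hδ₂, fun c hc h1 hcτ => ?_, fun d hd hτd h1 => ?_⟩
    · refine step c τ hc hcτ hτ.2 ?_
      have := H₁ c hcτ.le (by linarith [min_le_left δ₁ δ₂])
      linarith [hA.mono.le_rightLim (le_refl c)]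
    · exact step τ d hτ.1 hτd hd (H₂ d hτd (by linarith [min_le_right δ₁ δ₂])).le

theorem IsForwardMatrix.norm_sub_le_defectVariation [CompleteSpace E] (hΦ : IsForwardMatrix A Φ)
    (hA : IsControl v A 0) {y : ℝ → E} {s t K γ : ℝ} (hs : 0 ≤ s) (hst : s ≤ t)
    (hy : IsAdmissible s y) (hγ : 0 ≤ γ) (hV : defectVariation A s y ≤ ENNReal.ofReal γ)
    (hK : ∀ r ∈ Icc s t, ‖Φ t r‖ ≤ K) : ‖y t - Φ t s (y s)‖ ≤ K * γ := by
  obtain ⟨w, hw⟩ := exists_isControl hy.1 hy.2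
  set g : ℝ → E := fun q => y q - kurzweilIntegral (fun τ r => A r (y τ)) s q with hg
  have hle : eVariationOn g (Icc s t) ≤ ENNReal.ofReal γ :=
    (le_iSup₂ (f := fun t (_ : t ≥ s) => eVariationOn g (Icc s t)) t hst).trans hV
  have hbv : BoundedVariationOn g (Icc s t) := ne_top_of_le_ne_top ENNReal.ofReal_ne_top hle
  have h := hΦ.norm_sub_le hA (ν := variationOnFromTo g (Icc s t) s) hs hst hw
    (fun p q hp hpq hq => norm_sub_le_variationOnFromTo hbv.locallyBoundedVariationOn
      ⟨le_rfl, hst⟩ ⟨hp, hpq.trans hq⟩ ⟨hp.trans hpq, hq⟩ hpq) hK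
  refine h.trans (mul_le_mul_of_nonneg_left ?_ ((norm_nonneg _).trans (hK s ⟨le_rfl, hst⟩)))
  rw [variationOnFromTo.self, sub_zero, variationOnFromTo.eq_of_le _ _ hst, inter_self]
  exact ENNReal.toReal_le_of_le_ofReal hγ hle

/-- Solutions are admissible test functions with zero defect. -/
theorem VariationallyAsymptoticallyStable.uniformlyAsymptoticallyStable [CompleteSpace E]
    (hA : IsControl v A 0) (h : VariationallyAsymptoticallyStable A) :
    UniformlyAsymptoticallyStable A := by
  obtain ⟨h1, δ₀, hδ₀, h2⟩ := h
  refine ⟨fun ε hε => ?_, δ₀, hδ₀, fun ε hε => ?_⟩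
  · obtain ⟨δ, hδ, H⟩ := h1 ε hε
    refine ⟨δ, hδ, fun s hs x hx hxs => H s hs x (hx.isAdmissible hA hs) hxs ?_⟩
    rw [hx.defectVariation_eq_zero]
    exact ENNReal.ofReal_pos.2 hδ
  · obtain ⟨T, hT, γ, hγ, H⟩ := h2 ε hε
    refine ⟨T, hT, fun s hs x hx hxs => H s hs x (hx.isAdmissible hA hs) hxs ?_⟩
    rw [hx.defectVariation_eq_zero]
    exact ENNReal.ofReal_pos.2 hγ

theorem opNorm_le_of_ball_bound (L : E →L[ℝ] E) {δ η : ℝ} (hδ : 0 < δ) (hη : 0 ≤ η)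
    (h : ∀ e, ‖e‖ < δ → ‖L e‖ ≤ η) : ‖L‖ ≤ 2 * η / δ := by
  refine L.opNorm_le_bound (by positivity) fun e => ?_
  rcases eq_or_ne e 0 with rfl | he
  · simp
  have hpos : 0 < ‖e‖ := norm_pos_iff.2 he
  -- The ball is open, so vectors are scaled to norm `δ / 2`; this is the source of the factor `2`.
  have h1 := h ((δ / (2 * ‖e‖)) • e) (by
    rw [norm_smul, Real.norm_of_nonneg (by positivity)]
    have : δ / (2 * ‖e‖) * ‖e‖ = δ / 2 := by field_simp
    linarith)
  rw [map_smul, norm_smul, Real.norm_of_nonneg (by positivity), div_mul_eq_mul_div,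
    div_le_iff₀ (by positivity)] at h1
  rw [div_mul_eq_mul_div, le_div_iff₀ hδ]
  linarith

theorem IsForwardMatrix.hasUniformExponentialDecay (hΦ : IsForwardMatrix A Φ)
    (hA : IsControl v A 0) {C T : ℝ} (hC : 0 < C) (hT : 0 < T)
    (h1 : ∀ s ≥ 0, ∀ t ≥ s, ‖Φ t s‖ ≤ C) (h2 : ∀ s ≥ 0, ∀ t ≥ s + T, ‖Φ t s‖ ≤ 1 / 2) :
    HasUniformExponentialDecay Φ := by
  have key : ∀ n : ℕ, ∀ s ≥ 0, ∀ t ≥ s + n * T, ‖Φ t s‖ ≤ C * (1 / 2) ^ n := by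
    intro n
    induction n with
    | zero => intro s hs t ht; simpa using h1 s hs t (by simpa using ht)
    | succ n ih =>
      intro s hs t ht
      push_cast at ht
      have hnT : 0 ≤ n * T := by positivity
      rw [hΦ.mul hA hs (show s ≤ s + T by linarith) (show s + T ≤ t by linarith)]
      refine (norm_mul_le _ _).trans ?_
      rw [pow_succ, ← mul_assoc]
      have e1 := ih (s + T) (by positivity) t (by linarith)
      have e2 := h2 s hs (s + T) le_rfl
      gcongr
  have hlog : 0 < Real.log 2 := Real.log_pos one_lt_two
  -- Halving once per time `T` is decay at rate `log 2 / T`; the factor `2` pays for rounding `(t -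
  -- s) / T` down.
  refine ⟨2 * C, by positivity, Real.log 2 / T, by positivity, fun s hs t hst => ?_⟩
  have hq : 0 ≤ (t - s) / T := div_nonneg (sub_nonneg.2 hst) hT.le
  have hn : (⌊(t - s) / T⌋₊ : ℝ) * T ≤ t - s := by
    rw [← le_div_iff₀ hT]; exact Nat.floor_le hq
  have hn' : (t - s) / T < ⌊(t - s) / T⌋₊ + 1 := Nat.lt_floor_add_one _
  refine (key _ s hs t (by linarith)).trans ?_
  have hpow : (1 / 2 : ℝ) ^ ⌊(t - s) / T⌋₊ = Real.exp (-(⌊(t - s) / T⌋₊ * Real.log 2)) := by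
    rw [Real.exp_neg, mul_comm, Real.exp_mul, Real.exp_log two_pos, Real.rpow_natCast, one_div,
      inv_pow]
  have hexp : Real.exp (-(⌊(t - s) / T⌋₊ * Real.log 2)) ≤
      2 * Real.exp (-(Real.log 2 / T) * (t - s)) := by
    nth_rewrite 2 [← Real.exp_log two_pos]
    rw [← Real.exp_add]
    refine Real.exp_le_exp.2 ?_
    have : Real.log 2 / T * (t - s) = (t - s) / T * Real.log 2 := by ring
    nlinarith
  rw [hpow]
  nlinarith

theorem UniformlyAsymptoticallyStable.hasUniformExponentialDecay
    (h : UniformlyAsymptoticallyStable A) (hΦ : IsForwardMatrix A Φ) (hA : IsControl v A 0) :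
    HasUniformExponentialDecay Φ := by
  obtain ⟨hst, δ₀, hδ₀, hatt⟩ := h
  obtain ⟨δ, hδ, H⟩ := hst 1 one_pos
  obtain ⟨T, hT, H'⟩ := hatt (δ₀ / 4) (by positivity)
  have hinit : ∀ s ≥ 0, ∀ e : E, Φ s s e = e := fun s hs e => by
    rw [hΦ.diag s hs, one_apply_eq_self]
  -- Reaching `δ₀ / 4` from the ball of radius `δ₀` gives the operator bound `2 * (δ₀ / 4) / δ₀ = 1
  -- / 2`. The time is `T + 1` because `T` may be `0`.
  refine hΦ.hasUniformExponentialDecay hA (C := 2 * 1 / δ) (T := T + 1) (by positivity)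
    (by positivity) (fun s hs t ht => ?_) fun s hs t ht => ?_
  · exact opNorm_le_of_ball_bound _ hδ zero_le_one fun e he =>
      (H s hs _ ((hΦ.sol s hs).apply_const e) (by rwa [hinit s hs]) t ht).le
  · refine (opNorm_le_of_ball_bound _ hδ₀ (η := δ₀ / 4) (by positivity) fun e he =>
      (H' s hs _ ((hΦ.sol s hs).apply_const e) (by rwa [hinit s hs]) t (by linarith)).le).trans ?_
    rw [div_le_iff₀ hδ₀]
    linarith

theorem HasUniformExponentialDecay.variationallyAsymptoticallyStable [CompleteSpace E]
    (h : HasUniformExponentialDecay Φ) (hΦ : IsForwardMatrix A Φ) (hA : IsControl v A 0) :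
    VariationallyAsymptoticallyStable A := by
  obtain ⟨K, hK, α, hα, H⟩ := h
  have hle : ∀ s ≥ 0, ∀ t ≥ s, ‖Φ t s‖ ≤ K := by
    intro s hs t hst
    refine (H s hs t hst).trans (mul_le_of_le_one_right hK.le (Real.exp_le_one_iff.2 ?_))
    nlinarith
  -- Initial value and defect contribute separately; below each is made at most `ε / 4`.
  have hest : ∀ γ > 0, ∀ s ≥ 0, ∀ y : ℝ → E, IsAdmissible s y →
      defectVariation A s y < ENNReal.ofReal γ → ∀ t ≥ s, ‖y t‖ ≤ ‖Φ t s‖ * ‖y s‖ + K * γ := by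
    intro γ hγ s hs y hy hV t hst
    have h1 := hΦ.norm_sub_le_defectVariation hA hs hst hy hγ.le hV.le
      (fun r hr => hle r (hs.trans hr.1) t hr.2)
    have h2 := norm_le_norm_sub_add (y t) (Φ t s (y s))
    linarith [(Φ t s).le_opNorm (y s)]
  constructor
  · intro ε hε
    refine ⟨ε / (4 * K), by positivity, fun s hs y hy hys hV t hst => ?_⟩
    have h1 := hest _ (by positivity) s hs y hy hV t hst
    have h2 : ‖Φ t s‖ * ‖y s‖ ≤ K * (ε / (4 * K)) :=
      mul_le_mul (hle s hs t hst) hys.le (norm_nonneg _) hK.le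
    have h3 : K * (ε / (4 * K)) = ε / 4 := by field_simp
    linarith
  · refine ⟨1, one_pos, fun ε hε => ?_⟩
    have hlim : Tendsto (fun T : ℝ => K * Real.exp (-α * T)) atTop (𝓝 0) := by
      have := (Real.tendsto_exp_atBot.comp
        (tendsto_id.const_mul_atTop_of_neg (neg_lt_zero.2 hα))).const_mul K
      simpa using this
    obtain ⟨T, hT, hT0⟩ := ((hlim.eventually (gt_mem_nhds (show 0 < ε / 4 by positivity))).and
      (eventually_ge_atTop 0)).exists
    refine ⟨T, hT0, ε / (4 * K), by positivity, fun s hs y hy hys hV t ht => ?_⟩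
    have hst : s ≤ t := by linarith
    have h1 := hest _ (by positivity) s hs y hy hV t hst
    have h2 : ‖Φ t s‖ ≤ ε / 4 := by
      refine (H s hs t hst).trans (le_trans ?_ hT.le)
      gcongr K * Real.exp ?_
      nlinarith
    have h3 : ‖Φ t s‖ * ‖y s‖ ≤ ε / 4 * 1 :=
      mul_le_mul h2 hys.le (norm_nonneg _) (by positivity)
    have h4 : K * (ε / (4 * K)) = ε / 4 := by field_simp
    linarith

theorem HasUniformExponentialDecay.globallyUniformlyExponentiallyStable
    (h : HasUniformExponentialDecay Φ) (hΦ : IsForwardMatrix A Φ) (hA : IsControl v A 0) :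
    GloballyUniformlyExponentiallyStable A := by
  obtain ⟨K, hK, α, hα, H⟩ := h
  refine ⟨K, hK, α, hα, fun s hs x hx t hst => ?_⟩
  rw [hΦ.eq_apply hA hs hst (hx.mono Icc_subset_Ici_self), mul_right_comm]
  exact (Φ t s).le_of_opNorm_le (H s hs t hst) (x s)

theorem GloballyUniformlyExponentiallyStable.uniformlyAsymptoticallyStable
    (h : GloballyUniformlyExponentiallyStable A) : UniformlyAsymptoticallyStable A := by
  obtain ⟨K, hK, α, hα, H⟩ := h
  refine ⟨fun ε hε => ⟨ε / K, by positivity, fun s hs x hx hxs t hst => ?_⟩, 1, one_pos,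
    fun ε hε => ?_⟩
  · refine (H s hs x hx t hst).trans_lt ?_
    have h1 : K * ‖x s‖ < ε := by rwa [mul_comm, ← lt_div_iff₀ hK]
    refine (mul_le_of_le_one_right (by positivity) (Real.exp_le_one_iff.2 ?_)).trans_lt h1
    nlinarith
  · have hlim : Tendsto (fun T : ℝ => K * Real.exp (-α * T)) atTop (𝓝 0) := by
      have := (Real.tendsto_exp_atBot.comp
        (tendsto_id.const_mul_atTop_of_neg (neg_lt_zero.2 hα))).const_mul K
      simpa using this
    obtain ⟨T, hT, hT0⟩ := ((hlim.eventually (gt_mem_nhds hε)).and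
      (eventually_ge_atTop 0)).exists
    refine ⟨T, hT0, fun s hs x hx hxs t ht => ?_⟩
    refine (H s hs x hx t (by linarith)).trans_lt (lt_of_le_of_lt ?_ hT)
    have h1 : K * ‖x s‖ ≤ K := mul_le_of_le_one_right hK.le hxs.le
    exact mul_le_mul h1 (Real.exp_le_exp.2 (by nlinarith)) (Real.exp_pos _).le hK.le

theorem hasUniformExponentialDecay_twoSided :
    HasUniformExponentialDecay (twoSided Φ) ↔ HasUniformExponentialDecay Φ := by
  have h : ∀ s t, s ≤ t → twoSided Φ t s = Φ t s := fun s t hst => twoSided_of_le hst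
  constructor
  · rintro ⟨K, hK, α, hα, H⟩
    exact ⟨K, hK, α, hα, fun s hs t hst => h s t hst ▸ H s hs t hst⟩
  · rintro ⟨K, hK, α, hα, H⟩
    exact ⟨K, hK, α, hα, fun s hs t hst => (h s t hst).symm ▸ H s hs t hst⟩

end Stability

end GLDE

theorem theorem5p3 {E : Type*} [NormedAddCommGroup E] [NormedSpace ℝ E] [FiniteDimensional ℝ E]
    (A : ℝ → E →L[ℝ] E)
    (hBV : LocallyBoundedVariationOn A (Ici 0))
    (hleft : ∀ t > 0, ContinuousWithinAt A (Iio t) t)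
    (hD : GLDE.ConditionD A) :
    ∃ U : ℝ → ℝ → E →L[ℝ] E,
      GLDE.IsTransitionMatrix A U ∧
      (∀ V : ℝ → ℝ → E →L[ℝ] E, GLDE.IsTransitionMatrix A V →
        ∀ t ≥ 0, ∀ s ≥ 0, V t s = U t s) ∧
      (GLDE.VariationallyAsymptoticallyStable A ↔ GLDE.HasUniformExponentialDecay U) ∧
      (GLDE.VariationallyAsymptoticallyStable A ↔ GLDE.UniformlyAsymptoticallyStable A) ∧
      (GLDE.VariationallyAsymptoticallyStable A ↔
        GLDE.GloballyUniformlyExponentiallyStable A) := by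
  have : CompleteSpace E := FiniteDimensional.complete ℝ E
  obtain ⟨v, hA⟩ := GLDE.exists_isControl hBV hleft
  obtain ⟨Φ, hΦ⟩ := hA.exists_isForwardMatrix
  have vu : GLDE.VariationallyAsymptoticallyStable A → GLDE.UniformlyAsymptoticallyStable A :=
    fun h => h.uniformlyAsymptoticallyStable hA
  have ud : GLDE.UniformlyAsymptoticallyStable A → GLDE.HasUniformExponentialDecay Φ :=
    fun h => h.hasUniformExponentialDecay hΦ hA
  have dv : GLDE.HasUniformExponentialDecay Φ → GLDE.VariationallyAsymptoticallyStable A :=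
    fun h => h.variationallyAsymptoticallyStable hΦ hA
  refine ⟨GLDE.twoSided Φ, hΦ.isTransitionMatrix hA hD.2,
    fun V hV t ht s hs => hV.eq_twoSided hΦ hA hD.2 ht hs, ?_, ⟨vu, fun h => dv (ud h)⟩,
    fun h => (ud (vu h)).globallyUniformlyExponentiallyStable hΦ hA,
    fun h => dv (ud h.uniformlyAsymptoticallyStable)⟩
  rw [GLDE.hasUniformExponentialDecay_twoSided]
  exact ⟨fun h => ud (vu h), dv⟩
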